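/- Let $\mathcal H$ be an infinite-dimensional complex Hilbert space, let $B(\mathcal H)$ be the algebra of bounded linear operators on $\mathcal H$, and let $\mathcal D$ be the set of pairs $(A,B)$ of positive semi-definite operators in $B(\mathcal H)$. Let $F$ be a map which assigns to every $(A,B)\in\mathcal D$ a self-adjoint operator $F(A,B)\in B(\mathcal H)$, and suppose that $F$ is regular, that is, (a) $F(u^*Au,u^*Bu)=u^*F(A,B)u$ for all $(A,B)\in\mathcal D$ and every unitary operator $u$ on $\mathcal H$; and (b) $F(pxp+qxq,\,pyp+qyq)=p\,F(pxp,pyp)\,p+q\,F(qxq,qyq)\,q$ whenever $p$ and $q$ are mutually orthogonal projections on $\mathcal H$ with $p+q=1$, and $x,y\in B(\mathcal H)$ are such that $(pxp,pyp)$ and $(qxq,qyq)$ are in $\mathcal D$. Suppose moreover that (i) $F(tA,tB)=t\,F(A,B)$ for all $(A,B)\in\mathcal D$ and $t>0$; (ii) $\displaystyle F\Bigl(\frac{A_1+A_2}{2},\frac{B_1+B_2}{2}\Bigr)\le\frac{F(A_1,B_1)+F(A_2,B_2)}{2}$ for all $(A_1,B_1),(A_2,B_2)\in\mathcal D$; (iii)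 $F(0,0)=0$, and the map $B\mapsto F(1,B)$ is continuous, in the strong operator topology, on bounded sets of positive semi-definite operators, where $1$ is the identity operator on $\mathcal H$. Then there is an operator convex function $f\colon(0,\infty)\to\mathbf R$ such that \[ F(1,t\cdot 1)=f(t)\cdot 1\qquad\text{for all } t>0, \] and \[ F(A,B)=A^{1/2}f\bigl(A^{-1/2}BA^{-1/2}\bigr)A^{1/2} \] for all positive definite invertible operators $A,B\in B(\mathcal H)$. Here $f$ is operator convex if it is continuous and $f(sA+(1-s)B)\le s f(A)+(1-s)f(B)$ for all $s\in[0,1]$ and all bounded self-adjoint operators $A,B$ with spectra in $(0,\infty)$ on any complex Hilbert space. -/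

import Mathlib

universe u v

/-- The strong operator topology on `B(H)`, the coarsest topology for which `T ↦ T ξ` is continuous
for every vector `ξ`: Mathlib's topology of pointwise convergence, read on `H →L[ℂ] H`. -/
@[reducible] noncomputable def strongOperatorTopology (H : Type u) [NormedAddCommGroup H] [InnerProductSpace ℂ H] :
    TopologicalSpace (H →L[ℂ] H) :=
  TopologicalSpace.induced (ContinuousLinearMap.toPointwiseConvergenceCLM ℂ (RingHom.id ℂ) H H)
    inferInstance

/-- `g : B(H) → B(H)` is continuous on bounded subsets of `S`, in the strong operator topology
(on the source as well as on the target). -/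
def StronglyContinuousOnBounded {H : Type u} [NormedAddCommGroup H] [InnerProductSpace ℂ H]
    (g : (H →L[ℂ] H) → (H →L[ℂ] H)) (S : Set (H →L[ℂ] H)) : Prop :=
  ∀ T : Set (H →L[ℂ] H), T ⊆ S → Bornology.IsBounded T →
    @ContinuousOn _ _ (strongOperatorTopology H) (strongOperatorTopology H) g T

/-- A map `F` of two operator variables, considered on the convex domain `D` (its values outside `D`
play no role), is regular if it is unitarily covariant and respects the block diagonal
decompositions given by a pair of complementary orthogonal projections `p` and `q`. -/
structure IsRegularOperatorMap {H : Type u} [NormedAddCommGroup H] [InnerProductSpace ℂ H]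
    [CompleteSpace H] (D : Set ((H →L[ℂ] H) × (H →L[ℂ] H)))
    (F : (H →L[ℂ] H) → (H →L[ℂ] H) → (H →L[ℂ] H)) : Prop where
  convex_domain : Convex ℝ D
  unitary_mem : ∀ w ∈ unitary (H →L[ℂ] H), ∀ x y : H →L[ℂ] H, (x, y) ∈ D →
    (star w * x * w, star w * y * w) ∈ D
  unitary_map : ∀ w ∈ unitary (H →L[ℂ] H), ∀ x y : H →L[ℂ] H, (x, y) ∈ D →
    F (star w * x * w) (star w * y * w) = star w * F x y * w
  block_mem : ∀ p q : H →L[ℂ] H, IsStarProjection p → IsStarProjection q → p + q = 1 →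
    ∀ x y : H →L[ℂ] H, (p * x * p, p * y * p) ∈ D → (q * x * q, q * y * q) ∈ D →
      (p * x * p + q * x * q, p * y * p + q * y * q) ∈ D
  block_map : ∀ p q : H →L[ℂ] H, IsStarProjection p → IsStarProjection q → p + q = 1 →
    ∀ x y : H →L[ℂ] H, (p * x * p, p * y * p) ∈ D → (q * x * q, q * y * q) ∈ D →
      F (p * x * p + q * x * q) (p * y * p + q * y * q) =
        p * F (p * x * p) (p * y * p) * p + q * F (q * x * q) (q * y * q) * q

/-- The pairs of bounded positive semi-definite operators on `H`. -/
def psdPairs (H : Type u) [NormedAddCommGroup H] [InnerProductSpace ℂ H] [CompleteSpace H] :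
    Set ((H →L[ℂ] H) × (H →L[ℂ] H)) :=
  {P | 0 ≤ P.1 ∧ 0 ≤ P.2}

/-- `f` is operator convex on the interval `I`:
`f (s A + (1 - s) B) ≤ s f(A) + (1 - s) f(B)` for all bounded self-adjoint operators `A`, `B` with
spectra in `I` on any complex Hilbert space and all `s ∈ [0, 1]`. Continuity is part of the
definition, so that `f(A)` is always given by the continuous functional calculus. -/
def OperatorConvexOn (I : Set ℝ) (f : ℝ → ℝ) : Prop :=
  ContinuousOn f I ∧
  ∀ (K : Type v) [NormedAddCommGroup K] [InnerProductSpace ℂ K] [CompleteSpace K]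
    (A B : K →L[ℂ] K), IsSelfAdjoint A → IsSelfAdjoint B →
    spectrum ℝ A ⊆ I → spectrum ℝ B ⊆ I →
    ∀ s : ℝ, 0 ≤ s → s ≤ 1 →
      cfc f (s • A + (1 - s) • B) ≤ s • cfc f A + (1 - s) • cfc f B

open Filter Topology

/-! Regularity makes `F 1 (t • 1)` commute with every projection, so it is a scalar `f t`; the
strong continuity hypothesis serves to make `f` continuous. Homogeneity and midpoint convexity give
subadditivity. With D = A^(-1/2) B A^(-1/2), the formula F(A,B) = A^(1/2) f(D) A^(1/2) is proved as
two inequalities.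

Both rest on Jensen's inequality F(KAK, KBK) ≤ K F(A,B) K in a corner p whose complement contains a
copy of p (`map_conj_le`). After scaling, K is the p-corner of a unitary, and F(pXp, pYp) ≤ p F(X,Y)
p follows by averaging over the reflection 2p - 1.

Lower bound (`perspective_le`): a finite-rank corner P always has room in its complement.
Diagonalisation gives F(P, PD) = f(D) P when D commutes with P, and Jensen with an invertible root
turns this into the bound for the compressed pair. The compressions of A and B converge strongly,
and so do the functional calculi.

Upper bound (`map_le_perspective`): Bernstein weights split A and B as sums of M_k and d_k M_k,
where M_k = A^(1/2) w_k(D) A^(1/2). Subadditivity and F(M, tM) ≤ f(t) M (`map_smul_le`) bound F(A,B)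
by the sum of the f(d_k) M_k, which is close to A^(1/2) f(D) A^(1/2). Since an invertible M leaves
no complement, it is first cut into two pieces by isometries with complementary ranges.

For A = 1 the formula reads F(1,B) = f(B), so f is midpoint convex on operators on H.
Finite-dimensional compressions embed in H and carry this to every Hilbert space. -/

theorem ContinuousLinearMap.re_inner_mono {K : Type*} [NormedAddCommGroup K]
    [InnerProductSpace ℂ K] {S T : K →L[ℂ] K} (h : S ≤ T) (ξ : K) :
    (inner ℂ (S ξ) ξ).re ≤ (inner ℂ (T ξ) ξ).re := by
  have := ((ContinuousLinearMap.le_def _ _).1 h).re_inner_nonneg_left ξ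
  simpa [inner_sub_left] using this

theorem re_inner_real_smul_left {K : Type*} [NormedAddCommGroup K] [InnerProductSpace ℂ K]
    (c : ℝ) (x y : K) : (inner ℂ (c • x) y).re = c * (inner ℂ x y).re := by
  rw [← Complex.coe_smul, inner_smul_left, Complex.conj_ofReal, Complex.re_ofReal_mul]

/-! ### Operator order and spectral bounds -/

section Order

variable {K : Type*} [NormedAddCommGroup K] [InnerProductSpace ℂ K] [CompleteSpace K]

theorem ContinuousLinearMap.le_iff_re_inner {S T : K →L[ℂ] K} (hS : IsSelfAdjoint S)
    (hT : IsSelfAdjoint T) :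
    S ≤ T ↔ ∀ ξ, (inner ℂ (S ξ) ξ).re ≤ (inner ℂ (T ξ) ξ).re := by
  rw [ContinuousLinearMap.le_def, ContinuousLinearMap.isPositive_def']
  simp only [hT.sub hS, true_and, ContinuousLinearMap.reApplyInnerSelf_apply,
    _root_.sub_apply, inner_sub_left, map_sub, sub_nonneg]
  rfl

theorem spectrum_subset_Icc {a b : ℝ} {T : K →L[ℂ] K} (hT : IsSelfAdjoint T)
    (ha : a • 1 ≤ T) (hb : T ≤ b • 1) : spectrum ℝ T ⊆ Set.Icc a b := by
  intro x hx
  rw [← Algebra.algebraMap_eq_smul_one] at ha hb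
  exact ⟨(algebraMap_le_iff_le_spectrum (ha := hT)).1 ha x hx,
    (le_algebraMap_iff_spectrum_le (ha := hT)).1 hb x hx⟩

theorem smul_one_le_of_spectrum_subset {a b : ℝ} {T : K →L[ℂ] K} (hT : IsSelfAdjoint T)
    (h : spectrum ℝ T ⊆ Set.Icc a b) : a • 1 ≤ T ∧ T ≤ b • 1 := by
  rw [← Algebra.algebraMap_eq_smul_one, ← Algebra.algebraMap_eq_smul_one]
  exact ⟨(algebraMap_le_iff_le_spectrum (ha := hT)).2 fun x hx => (h hx).1,
    (le_algebraMap_iff_spectrum_le (ha := hT)).2 fun x hx => (h hx).2⟩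

theorem exists_spectrum_subset_Icc {T : K →L[ℂ] K} (h : spectrum ℝ T ⊆ Set.Ioi 0) :
    ∃ a b : ℝ, 0 < a ∧ a ≤ 1 ∧ 1 ≤ b ∧ spectrum ℝ T ⊆ Set.Icc a b := by
  have hc : IsCompact (spectrum ℝ T) := spectrum.isCompact T
  rcases (spectrum ℝ T).eq_empty_or_nonempty with he | hne
  · exact ⟨1, 1, one_pos, le_rfl, le_rfl, by simp [he]⟩
  · obtain ⟨x, hx, hmin⟩ := hc.exists_isMinOn hne continuousOn_id
    obtain ⟨y, hy, hmax⟩ := hc.exists_isMaxOn hne continuousOn_id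
    refine ⟨min x 1, max y 1, lt_min (h hx) one_pos, min_le_right _ _, le_max_right _ _, ?_⟩
    exact fun z hz => ⟨(min_le_left _ _).trans (hmin hz), (hmax hz).trans (le_max_left _ _)⟩

theorem isStrictlyPositive_of_smul_one_le {a : ℝ} (ha : 0 < a) {T : K →L[ℂ] K}
    (h : a • 1 ≤ T) : IsStrictlyPositive T := by
  have hT : IsSelfAdjoint T := .of_nonneg ((smul_nonneg ha.le zero_le_one).trans h)
  rw [StarOrderedRing.isStrictlyPositive_iff_spectrum_pos (R := ℝ) T]
  rw [← Algebra.algebraMap_eq_smul_one] at h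
  exact fun x hx => ha.trans_le ((algebraMap_le_iff_le_spectrum (ha := hT)).1 h x hx)

theorem IsStrictlyPositive.exists_spectrum_subset_Icc {T : K →L[ℂ] K} (h : IsStrictlyPositive T) :
    ∃ a b : ℝ, 0 < a ∧ a ≤ 1 ∧ 1 ≤ b ∧ spectrum ℝ T ⊆ Set.Icc a b :=
  _root_.exists_spectrum_subset_Icc
    ((StarOrderedRing.isStrictlyPositive_iff_spectrum_pos (R := ℝ) T).1 h)

theorem norm_le_of_smul_one_le {a b : ℝ} (ha : 0 ≤ a) {T : K →L[ℂ] K}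
    (h1 : a • 1 ≤ T) (h2 : T ≤ b • 1) (hb : 0 ≤ b) : ‖T‖ ≤ b := by
  have h0 : 0 ≤ T := (smul_nonneg ha zero_le_one).trans h1
  rw [← Algebra.algebraMap_eq_smul_one] at h2
  exact (CStarAlgebra.norm_le_iff_le_algebraMap T hb h0).2 h2

end Order

/-! ### Strong continuity of the functional calculus -/

section FunctionalCalculus

variable {K H : Type*} [NormedAddCommGroup K] [InnerProductSpace ℂ K] [CompleteSpace K]
  [NormedAddCommGroup H] [InnerProductSpace ℂ H] [CompleteSpace H]

theorem norm_cfc_sub_aeval_le {a b ε : ℝ} (hε : 0 ≤ ε) {g : ℝ → ℝ}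
    (hg : ContinuousOn g (Set.Icc a b)) {q : Polynomial ℝ}
    (hq : ∀ x ∈ Set.Icc a b, |q.eval x - g x| ≤ ε) {T : K →L[ℂ] K} (hT : IsSelfAdjoint T)
    (hs : spectrum ℝ T ⊆ Set.Icc a b) : ‖cfc g T - Polynomial.aeval T q‖ ≤ ε := by
  rw [← cfc_polynomial q T, ← cfc_sub g _ T (hg.mono hs) (by fun_prop)]
  refine norm_cfc_le hε fun x hx => ?_
  rw [Real.norm_eq_abs, abs_sub_comm]
  exact hq x (hs hx)

theorem norm_le_of_spectrum_subset_Icc {a b : ℝ} {T : K →L[ℂ] K} (hT : IsSelfAdjoint T)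
    (hs : spectrum ℝ T ⊆ Set.Icc a b) : ‖T‖ ≤ max |a| |b| := by
  conv_lhs => rw [← cfc_id' ℝ T]
  refine norm_cfc_le (by positivity) fun x hx => ?_
  exact abs_le_max_abs_abs (hs hx).1 (hs hx).2

/-- Functional calculus is strongly continuous on families with uniformly bounded spectrum, also
along an intertwining operator. -/
theorem tendsto_cfc_apply_of_intertwine {ι : Type*} {l : Filter ι} {a b : ℝ} {g : ℝ → ℝ}
    (hg : ContinuousOn g (Set.Icc a b)) {T : ι → H →L[ℂ] H} {S : K →L[ℂ] K} {V : K →L[ℂ] H}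
    (hT : ∀ i, IsSelfAdjoint (T i)) (hS : IsSelfAdjoint S)
    (hTs : ∀ i, spectrum ℝ (T i) ⊆ Set.Icc a b) (hSs : spectrum ℝ S ⊆ Set.Icc a b)
    (h : ∀ η, Tendsto (fun i => T i (V η)) l (𝓝 (V (S η)))) (η : K) :
    Tendsto (fun i => cfc g (T i) (V η)) l (𝓝 (V (cfc g S η))) := by
  have hpow : ∀ n : ℕ, ∀ η, Tendsto (fun i => (T i ^ n) (V η)) l (𝓝 (V ((S ^ n) η))) := by
    intro n
    induction n with
    | zero => intro η; simpa using tendsto_const_nhds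
    | succ n ih =>
      intro η
      -- The powers `T i ^ n` are bounded uniformly in `i`, so `T i (V η)` may be replaced by its
      -- limit before applying them.
      have h1 : Tendsto (fun i => (T i ^ n) (T i (V η) - V (S η))) l (𝓝 0) := by
        have h2 : Tendsto (fun i => (max |a| |b|) ^ n * ‖T i (V η) - V (S η)‖) l (𝓝 0) := by
          have := (tendsto_iff_norm_sub_tendsto_zero.1 (h η)).const_mul ((max |a| |b|) ^ n)
          simpa using this
        refine squeeze_zero_norm (fun i => ?_) h2
        refine ((T i ^ n).le_opNorm _).trans ?_
        gcongr
        rcases n.eq_zero_or_pos with rfl | hn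
        · rw [pow_zero, pow_zero]
          exact ContinuousLinearMap.norm_id_le
        · exact (norm_pow_le' _ hn).trans
            (pow_le_pow_left₀ (norm_nonneg _) (norm_le_of_spectrum_subset_Icc (hT i) (hTs i)) n)
      have h2 := h1.add (ih (S η))
      simp only [zero_add, map_sub, sub_add_cancel] at h2
      simpa [pow_succ] using h2
  have hpoly : ∀ q : Polynomial ℝ, ∀ η, Tendsto (fun i => (Polynomial.aeval (T i) q) (V η)) l
      (𝓝 (V ((Polynomial.aeval S q) η))) := by
    intro q
    induction q using Polynomial.induction_on' with
    | add p q hp hq =>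
      intro η
      simpa using (hp η).add (hq η)
    | monomial n c =>
      intro η
      have := (hpow n η).const_smul c
      simpa [Polynomial.aeval_monomial, Algebra.algebraMap_eq_smul_one] using this
  rw [Metric.tendsto_nhds]
  intro ε hε
  -- Chosen so that the two Weierstrass approximation errors, at `T i` and at `S`, add up to at most
  -- `ε / 3`.
  set δ : ℝ := ε / (3 * (‖V η‖ + ‖V‖ * ‖η‖ + 1)) with hδ
  have hδ0 : 0 < δ := by positivity
  obtain ⟨q, hq⟩ := exists_polynomial_near_of_continuousOn a b g hg δ hδ0
  have hq' : ∀ x ∈ Set.Icc a b, |q.eval x - g x| ≤ δ := fun x hx => (hq x hx).le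
  filter_upwards [Metric.tendsto_nhds.1 (hpoly q η) (ε / 3) (by positivity)] with i hi
  have e1 : ‖(cfc g (T i) - Polynomial.aeval (T i) q) (V η)‖ ≤ δ * ‖V η‖ :=
    ContinuousLinearMap.le_of_opNorm_le _ (norm_cfc_sub_aeval_le hδ0.le hg hq' (hT i) (hTs i)) _
  have e2 : ‖V ((cfc g S - Polynomial.aeval S q) η)‖ ≤ ‖V‖ * (δ * ‖η‖) :=
    ContinuousLinearMap.le_of_opNorm_le_of_le _ le_rfl
      (ContinuousLinearMap.le_of_opNorm_le _ (norm_cfc_sub_aeval_le hδ0.le hg hq' hS hSs) _)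
  rw [dist_eq_norm] at hi ⊢
  have e3 : cfc g (T i) (V η) - V (cfc g S η) = (cfc g (T i) - Polynomial.aeval (T i) q) (V η)
      + ((Polynomial.aeval (T i) q) (V η) - V ((Polynomial.aeval S q) η))
      - V ((cfc g S - Polynomial.aeval S q) η) := by
    simp
  have e4 : δ * ‖V η‖ + ‖V‖ * (δ * ‖η‖) ≤ ε / 3 := by
    have : δ * (3 * (‖V η‖ + ‖V‖ * ‖η‖ + 1)) = ε := by
      rw [hδ]; field_simp
    nlinarith
  rw [e3]
  calc _ ≤ _ := norm_sub_le _ _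
    _ ≤ _ := add_le_add_left (norm_add_le _ _) _
    _ < ε := by linarith

theorem cfc_comp_eq_of_intertwine {g : ℝ → ℝ} (hg : Continuous g) {T : H →L[ℂ] H} {S : K →L[ℂ] K}
    {V : K →L[ℂ] H} (hT : IsSelfAdjoint T) (hS : IsSelfAdjoint S)
    (h : ∀ η, T (V η) = V (S η)) (η : K) : cfc g T (V η) = V (cfc g S η) := by
  have hbd : ∀ {E : Type _} [NormedAddCommGroup E] [InnerProductSpace ℂ E] [CompleteSpace E]
      (R : E →L[ℂ] E), ∃ M, ∀ x ∈ spectrum ℝ R, |x| ≤ M := fun R =>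
    ((spectrum.isCompact (𝕜 := ℝ) R).isBounded.exists_norm_le)
  obtain ⟨M, hM⟩ := hbd T
  obtain ⟨N, hN⟩ := ((spectrum.isCompact (𝕜 := ℝ) S).isBounded.exists_norm_le)
  have := tendsto_cfc_apply_of_intertwine (ι := Unit) (l := ⊤) (a := -max M N) (b := max M N)
    (g := g) hg.continuousOn (T := fun _ => T) (S := S) (V := V) (fun _ => hT) hS
    (fun _ x hx => abs_le.1 ((hM x hx).trans (le_max_left _ _)))
    (fun x hx => abs_le.1 ((hN x hx).trans (le_max_right _ _)))
    (fun η => by rw [h]; exact tendsto_const_nhds) η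
  exact tendsto_nhds_unique tendsto_const_nhds this

/-- The map sending `1 : ℂ` to `ξ` intertwines `T` with multiplication by `t` on `ℂ`. -/
theorem cfc_apply_of_eigenvector {g : ℝ → ℝ} (hg : Continuous g) {T : H →L[ℂ] H}
    (hT : IsSelfAdjoint T) {t : ℝ} {ξ : H} (h : T ξ = t • ξ) : cfc g T ξ = g t • ξ := by
  have h0 : IsSelfAdjoint (algebraMap ℝ (ℂ →L[ℂ] ℂ) t) := IsSelfAdjoint.algebraMap _ (.all t)
  have := cfc_comp_eq_of_intertwine hg (S := algebraMap ℝ (ℂ →L[ℂ] ℂ) t)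
    (V := ContinuousLinearMap.toSpanSingleton ℂ ξ) hT h0
    (fun η => by
      simp [Algebra.algebraMap_eq_smul_one, h, mul_comm _ η, mul_smul]) 1
  rw [cfc_algebraMap] at this
  simpa [Algebra.algebraMap_eq_smul_one] using this

end FunctionalCalculus

/-- Subtract the chord. If the maximum were positive, its leftmost maximiser would be interior, and
it would be the midpoint of two points of which the left one has a strictly smaller value. -/
theorem continuousOn_midpoint_convex {φ : ℝ → ℝ} (hφ : ContinuousOn φ (Set.Icc 0 1))
    (hmid : ∀ x ∈ Set.Icc (0 : ℝ) 1, ∀ y ∈ Set.Icc (0 : ℝ) 1,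
      φ ((x + y) / 2) ≤ (φ x + φ y) / 2) {s : ℝ} (hs : s ∈ Set.Icc (0 : ℝ) 1) :
    φ s ≤ s * φ 1 + (1 - s) * φ 0 := by
  set g : ℝ → ℝ := fun x => φ x - (x * φ 1 + (1 - x) * φ 0) with hgdef
  have hg : ContinuousOn g (Set.Icc 0 1) := hφ.sub (by fun_prop)
  obtain ⟨m, hm, hmax⟩ := isCompact_Icc.exists_isMaxOn (Set.nonempty_Icc.2 zero_le_one) hg
  suffices h : g m ≤ 0 by
    have := (hmax hs).trans h
    simp only [hgdef] at this
    linarith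
  by_contra! hpos
  have hcl : IsCompact {x | x ∈ Set.Icc (0 : ℝ) 1 ∧ g x = g m} := by
    have : {x | x ∈ Set.Icc (0 : ℝ) 1 ∧ g x = g m} = Set.Icc 0 1 ∩ g ⁻¹' {g m} := rfl
    rw [this]
    exact isCompact_Icc.of_isClosed_subset
      (hg.preimage_isClosed_of_isClosed isClosed_Icc isClosed_singleton) Set.inter_subset_left
  obtain ⟨x, ⟨hx, hxm⟩, hmin⟩ := hcl.exists_isMinOn ⟨m, hm, rfl⟩ continuousOn_id
  have hx0 : x ≠ 0 := by rintro rfl; simp [hgdef] at hxm hpos; linarith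
  have hx1 : x ≠ 1 := by rintro rfl; simp [hgdef] at hxm hpos; linarith
  have hx0' : 0 < x := lt_of_le_of_ne hx.1 hx0.symm
  have hx1' : x < 1 := lt_of_le_of_ne hx.2 hx1
  obtain ⟨h, hh, h1, h2⟩ : ∃ h > 0, h ≤ x ∧ h ≤ 1 - x :=
    ⟨min x (1 - x), lt_min hx0' (by linarith), min_le_left _ _, min_le_right _ _⟩
  have m1 : x - h ∈ Set.Icc (0 : ℝ) 1 := ⟨by linarith, by linarith⟩
  have m2 : x + h ∈ Set.Icc (0 : ℝ) 1 := ⟨by linarith, by linarith⟩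
  have e := hmid _ m1 _ m2
  have e' : (x - h + (x + h)) / 2 = x := by ring
  rw [e'] at e
  have l1 : g (x - h) < g m := lt_of_le_of_ne (hmax m1) fun he => by
    have := hmin (show x - h ∈ _ from ⟨m1, he⟩)
    simp at this; linarith
  have l2 : g (x + h) ≤ g m := hmax m2
  simp only [hgdef] at l1 l2 hxm hpos
  nlinarith

theorem HilbertBasis.ext_inner {ι H : Type*} [NormedAddCommGroup H]
    [InnerProductSpace ℂ H] (b : HilbertBasis ι ℂ H)
    {x y : H}
    (h : ∀ i, inner ℂ (b i) x = inner ℂ (b i) y) : x = y := by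
  apply b.repr.injective
  ext i
  rw [b.repr_apply_apply, b.repr_apply_apply, h]

/-! ### Partial isometries and isometries with complementary ranges -/

section Isometries

variable {K H : Type*} [NormedAddCommGroup K] [InnerProductSpace ℂ K] [CompleteSpace K]
  [NormedAddCommGroup H] [InnerProductSpace ℂ H] [CompleteSpace H]

theorem exists_partialIsometry (hdim : ¬ FiniteDimensional ℂ H) (E : Submodule ℂ K)
    [FiniteDimensional ℂ E] :
    ∃ U : K →L[ℂ] H, ContinuousLinearMap.adjoint U ∘L U = E.starProjection := by
  have hr : ((Module.finrank ℂ E : ℕ) : Cardinal) ≤ Module.rank ℂ H := by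
    have : Cardinal.aleph0 ≤ Module.rank ℂ H := by
      by_contra! h
      exact hdim (Module.rank_lt_aleph0_iff.1 h)
    exact (Cardinal.natCast_le_aleph0).trans this
  obtain ⟨v, hv⟩ := exists_linearIndependent_of_le_rank hr
  have hfin : Module.finrank ℂ (Submodule.span ℂ (Set.range v)) = Module.finrank ℂ E := by
    rw [finrank_span_eq_card hv, Fintype.card_fin]
  have : FiniteDimensional ℂ (Submodule.span ℂ (Set.range v)) :=
    FiniteDimensional.span_of_finite ℂ (Set.finite_range v)
  let e := (stdOrthonormalBasis ℂ E).equiv (stdOrthonormalBasis ℂ (Submodule.span ℂ (Set.range v)))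
    (finCongr hfin.symm)
  let V : E →ₗᵢ[ℂ] H := (Submodule.span ℂ (Set.range v)).subtypeₗᵢ.comp e.toLinearIsometry
  refine ⟨V.toContinuousLinearMap ∘L E.orthogonalProjectionOnto, ?_⟩
  rw [ContinuousLinearMap.adjoint_comp, ContinuousLinearMap.comp_assoc,
    ← ContinuousLinearMap.comp_assoc (ContinuousLinearMap.adjoint V.toContinuousLinearMap),
    V.adjoint_comp_self, Submodule.adjoint_orthogonalProjectionOnto]
  rfl

/-- `Eᗮ` is still infinite-dimensional, so `E` embeds isometrically into it. This is the room that
Jensen's inequality needs. -/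
theorem exists_partialIsometry_orthogonal (hdim : ¬ FiniteDimensional ℂ H) (E : Submodule ℂ H)
    [FiniteDimensional ℂ E] :
    ∃ v : H →L[ℂ] H, star v * v = E.starProjection ∧ E.starProjection * v = 0 := by
  have hE : ¬ FiniteDimensional ℂ Eᗮ := by
    intro h
    apply hdim
    have h1 : FiniteDimensional ℂ (E ⊔ Eᗮ : Submodule ℂ H) := inferInstance
    rw [Submodule.sup_orthogonal_of_hasOrthogonalProjection] at h1
    exact Module.finite_def.2 (Module.Finite.iff_fg.1 h1)
  obtain ⟨U, hU⟩ := exists_partialIsometry hE E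
  refine ⟨Eᗮ.subtypeL ∘L U, ?_, ?_⟩
  · rw [ContinuousLinearMap.star_eq_adjoint, ContinuousLinearMap.mul_def,
      ContinuousLinearMap.adjoint_comp, ContinuousLinearMap.comp_assoc,
      ← ContinuousLinearMap.comp_assoc (ContinuousLinearMap.adjoint Eᗮ.subtypeL), ← hU]
    congr 1
    have h : ContinuousLinearMap.adjoint Eᗮ.subtypeL ∘L Eᗮ.subtypeL = 1 :=
      Eᗮ.subtypeₗᵢ.adjoint_comp_self
    rw [h]
    rfl
  · ext x
    simp only [ContinuousLinearMap.mul_def, ContinuousLinearMap.comp_apply,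
      _root_.zero_apply]
    exact (Submodule.starProjection_apply_eq_zero_iff _).2 (U x).2

theorem exists_cuntz_isometries (hdim : ¬ FiniteDimensional ℂ H) :
    ∃ V₁ V₂ : H →L[ℂ] H, star V₁ * V₁ = 1 ∧ star V₂ * V₂ = 1 ∧ star V₁ * V₂ = 0 ∧
      star V₂ * V₁ = 0 ∧ V₁ * star V₁ + V₂ * star V₂ = 1 := by
  classical
  obtain ⟨w, b, -⟩ := exists_hilbertBasis ℂ H
  have hw : Infinite w := by
    by_contra h
    rw [not_infinite_iff_finite] at h
    have := Fintype.ofFinite w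
    exact hdim b.toOrthonormalBasis.toBasis.finiteDimensional_of_finite
  -- An infinite index set is equipotent with two copies of itself; each isometry sends the basis to
  -- one of the two halves.
  obtain ⟨σ⟩ : Nonempty (w ⊕ w ≃ w) := by
    rw [← Cardinal.eq, Cardinal.mk_sum]
    simp [Cardinal.add_eq_self (Cardinal.aleph0_le_mk w)]
  have key : ∀ j : w → w ⊕ w, Function.Injective j → ∃ V : H →L[ℂ] H, star V * V = 1 ∧
      ∀ i, V (b i) = b (σ (j i)) := by
    intro j hj
    have ho : Orthonormal ℂ (fun i => b (σ (j i))) :=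
      b.orthonormal.comp _ (σ.injective.comp hj)
    let V := ho.orthogonalFamily.linearIsometry.comp b.repr.toLinearIsometry
    refine ⟨V.toContinuousLinearMap, V.adjoint_comp_self, fun i => ?_⟩
    change ho.orthogonalFamily.linearIsometry (b.repr (b i)) = _
    rw [b.repr_self, OrthogonalFamily.linearIsometry_apply_single]
    simp
  obtain ⟨V₁, h1, hV1⟩ := key Sum.inl Sum.inl_injective
  obtain ⟨V₂, h2, hV2⟩ := key Sum.inr Sum.inr_injective
  have h12 : star V₁ * V₂ = 0 := by
    refine ContinuousLinearMap.ext_on (s := Set.range b) ?_ ?_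
    · exact Submodule.dense_iff_topologicalClosure_eq_top.2 b.dense_span
    · rintro _ ⟨k, rfl⟩
      refine b.ext_inner fun i => ?_
      simp only [ContinuousLinearMap.mul_def, ContinuousLinearMap.comp_apply,
        ContinuousLinearMap.star_eq_adjoint, ContinuousLinearMap.adjoint_inner_right, hV1, hV2,
        _root_.zero_apply, inner_zero_right]
      exact b.orthonormal.2 (fun h => Sum.inl_ne_inr (σ.injective h))
  have h21 : star V₂ * V₁ = 0 := by simpa using congrArg star h12
  refine ⟨V₁, V₂, h1, h2, h12, h21, ?_⟩
  refine ContinuousLinearMap.ext_on (s := Set.range b)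
    (Submodule.dense_iff_topologicalClosure_eq_top.2 b.dense_span) ?_
  rintro _ ⟨k, rfl⟩
  obtain ⟨x, rfl⟩ := σ.surjective k
  have e : ∀ (S T : H →L[ℂ] H) η, S (T η) = (S * T) η := fun _ _ _ => rfl
  rcases x with i | i
  · rw [← hV1, e, add_mul, mul_assoc, mul_assoc, h1, h21]; simp
  · rw [← hV2, e, add_mul, mul_assoc, mul_assoc, h2, h12]; simp

end Isometries

/-! ### Unitary dilation of a contraction in a corner -/

section Dilation

variable {H : Type*} [NormedAddCommGroup H] [InnerProductSpace ℂ H] [CompleteSpace H]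

theorem CStarRing.mul_eq_self_of_star_mul_self_eq {A : Type*} [NormedRing A] [StarRing A]
    [CStarRing A] {p v : A} (hp : IsStarProjection p) (hv : star v * v = p) : v * p = v := by
  have hpp : p * p = p := hp.isIdempotentElem
  have hps : star p = p := hp.isSelfAdjoint
  have h : star (v * p - v) * (v * p - v) = 0 := by
    simp only [star_sub, star_mul, hps, sub_mul, mul_sub]
    rw [mul_assoc p (star v), ← mul_assoc (star v) v, hv, hpp, mul_assoc p (star v) v, hv, hpp]
    simp
  exact sub_eq_zero.1 (CStarRing.star_mul_self_eq_zero_iff _ |>.1 h)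

/-- Halmos' construction: the block matrix with rows (K, D) and (D, -K), acting on p and its copy v
v*, is a self-adjoint unitary; it is completed by the identity on the rest. -/
theorem exists_unitary_of_dilation {A : Type*} [Ring A] [StarRing A] {p v K D : A}
    (hpp : p * p = p) (hps : star p = p) (hv : star v * v = p) (hpv : p * v = 0) (hvp : v * p = v)
    (hK : star K = K) (hpK : p * K = K) (hD : star D = D) (hpD : p * D = D)
    (hKD : K * D = D * K) (hsq : K * K + D * D = p) :
    ∃ U ∈ unitary A, p * U * p = K := by
  have hKp : K * p = K := by simpa [hK, hps] using congrArg star hpK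
  have hDp : D * p = D := by simpa [hD, hps] using congrArg star hpD
  have hvp' : star v * p = 0 := by simpa [hps] using congrArg star hpv
  have hpv' : p * star v = star v := by simpa [hps] using congrArg star hvp
  have hKv : K * v = 0 := by rw [← hKp, mul_assoc, hpv, mul_zero]
  have hDv : D * v = 0 := by rw [← hDp, mul_assoc, hpv, mul_zero]
  have hvK : star v * K = 0 := by rw [← hpK, ← mul_assoc, hvp', zero_mul]
  have hvD : star v * D = 0 := by rw [← hpD, ← mul_assoc, hvp', zero_mul]
  set r : A := 1 - p - v * star v with hr
  have hrs : star r = r := by simp [hr, hps]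
  have hrp : p * r = 0 := by simp [hr, mul_sub, hpp, ← mul_assoc, hpv]
  have hrp' : r * p = 0 := by simpa [hps, hrs] using congrArg star hrp
  have hrv : r * v = 0 := by simp [hr, sub_mul, mul_assoc, hpv, hv, hvp]
  have hrv' : star v * r = 0 := by simpa [hrs] using congrArg star hrv
  have hrK : r * K = 0 := by rw [← hpK, ← mul_assoc, hrp', zero_mul]
  have hrD : r * D = 0 := by rw [← hpD, ← mul_assoc, hrp', zero_mul]
  have hKr : K * r = 0 := by rw [← hKp, mul_assoc, hrp, mul_zero]
  have hDr : D * r = 0 := by rw [← hDp, mul_assoc, hrp, mul_zero]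
  have hrr : r * r = r := by
    nth_rewrite 2 [hr]
    rw [mul_sub, mul_sub, hrp', ← mul_assoc, hrv]; simp
  have tr : ∀ {a b c : A}, a * b = c → ∀ x, a * (b * x) = c * x := fun h x => by
    rw [← mul_assoc, h]
  set U : A := K + v * D + D * star v - v * K * star v + r with hU
  have hUs : star U = U := by
    simp only [hU, star_add, star_sub, star_mul, star_star, hK, hD, hrs, mul_assoc]
    abel
  have hUU : U * U = 1 := by
    have e : U * U = (K * K + D * D) + (K * D - D * K) * star v + v * (D * K - K * D)
        + v * (K * K + D * D) * star v + r := by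
      simp only [hU, mul_add, add_mul, mul_sub, sub_mul, mul_assoc, tr hKv, tr hDv, hvK, tr hvD,
        tr hv, tr hpK, hpD, tr hrv, hrv', hrK, tr hrD, hKr, hDr, hrr, zero_mul, mul_zero]
      abel
    rw [e, hsq, hKD, sub_self, hvp, hr]
    simp
  refine ⟨U, ?_, ?_⟩
  · rw [Unitary.mem_iff, hUs]
    exact ⟨hUU, hUU⟩
  · simp only [hU, mul_add, add_mul, mul_sub, sub_mul, mul_assoc, hpK, hKp, tr hpv, hrp',
      hvp', mul_zero, zero_mul]
    simp

theorem exists_dilation {p v K : H →L[ℂ] H} (hp : IsStarProjection p) (hv : star v * v = p)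
    (hpv : p * v = 0) (hK : IsSelfAdjoint K) (hpK : p * K = K) (hK1 : ‖K‖ ≤ 1) :
    ∃ U ∈ unitary (H →L[ℂ] H), p * U * p = K := by
  have hpp : p * p = p := hp.isIdempotentElem
  have hps : star p = p := hp.isSelfAdjoint
  have hKp : K * p = K := by simpa [hK.star_eq, hps] using congrArg star hpK
  have hsa : IsSelfAdjoint (1 - K * K) := by
    rw [isSelfAdjoint_iff]; simp [hK.star_eq]
  have hnn : 0 ≤ 1 - K * K := by
    have h := CStarAlgebra.star_mul_le_algebraMap_norm_sq (a := K)
    rw [hK.star_eq] at h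
    refine sub_nonneg.2 (h.trans ?_)
    rw [← map_one (algebraMap ℝ (H →L[ℂ] H))]
    exact algebraMap_mono _ (pow_le_one₀ (norm_nonneg _) hK1)
  have hEE : cfc Real.sqrt (1 - K * K) * cfc Real.sqrt (1 - K * K) = 1 - K * K := by
    rw [← cfc_mul Real.sqrt Real.sqrt (1 - K * K)]
    conv_rhs => rw [← cfc_id' ℝ (1 - K * K)]
    refine cfc_congr fun x hx => ?_
    exact Real.mul_self_sqrt (spectrum_nonneg_of_nonneg hnn hx)
  have hc1 : Commute (cfc Real.sqrt (1 - K * K)) K := Commute.cfc_real (by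
    simp [Commute, SemiconjBy, sub_mul, mul_sub, mul_assoc]) _
  have hc2 : Commute (cfc Real.sqrt (1 - K * K)) p := Commute.cfc_real (by
    simp only [Commute, SemiconjBy, sub_mul, mul_sub, mul_assoc, hKp, one_mul, mul_one]
    rw [← mul_assoc, hpK]) _
  have hEs : star (cfc Real.sqrt (1 - K * K)) = cfc Real.sqrt (1 - K * K) :=
    (cfc_predicate Real.sqrt (1 - K * K))
  -- `E` is the defect operator; it commutes with `K` and `p`, so its corner `p * E` serves as the
  -- off-diagonal block.
  set E := cfc Real.sqrt (1 - K * K)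
  refine exists_unitary_of_dilation (D := p * E) hpp hps hv hpv
    (CStarRing.mul_eq_self_of_star_mul_self_eq hp hv) hK hpK ?_ ?_ ?_ ?_
  · rw [star_mul, hps, hEs, hc2.eq]
  · rw [← mul_assoc, hpp]
  · rw [← mul_assoc, hKp, mul_assoc, hc1.eq, ← mul_assoc, hpK]
  · rw [mul_assoc, ← mul_assoc E, hc2.eq, mul_assoc, ← mul_assoc p p, hpp, hEE, mul_sub, mul_one,
      ← mul_assoc, hpK]
    abel

end Dilation

/-- The properties of a regular, positively homogeneous and midpoint convex map of pairs of
positive operators that enter the analysis of its structure. -/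
structure IsRegularSublinear {H : Type*} [NormedAddCommGroup H] [InnerProductSpace ℂ H]
    [CompleteSpace H] (F : (H →L[ℂ] H) → (H →L[ℂ] H) → (H →L[ℂ] H)) : Prop where
  isSelfAdjoint : ∀ {A B : H →L[ℂ] H}, 0 ≤ A → 0 ≤ B → IsSelfAdjoint (F A B)
  unitary_map : ∀ {w A B : H →L[ℂ] H}, w ∈ unitary (H →L[ℂ] H) → 0 ≤ A → 0 ≤ B →
    F (star w * A * w) (star w * B * w) = star w * F A B * w
  mul_map : ∀ {p A B : H →L[ℂ] H}, IsStarProjection p → 0 ≤ A → 0 ≤ B → p * A = A * p →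
    p * B = B * p → p * F A B = F (p * A) (p * B)
  smul_map : ∀ {t : ℝ} {A B : H →L[ℂ] H}, 0 < t → 0 ≤ A → 0 ≤ B → F (t • A) (t • B) = t • F A B
  add_le : ∀ {A₁ A₂ B₁ B₂ : H →L[ℂ] H}, 0 ≤ A₁ → 0 ≤ A₂ → 0 ≤ B₁ → 0 ≤ B₂ →
    F (A₁ + A₂) (B₁ + B₂) ≤ F A₁ B₁ + F A₂ B₂
  map_zero : F 0 0 = 0

/-! ### Regular sublinear maps: compression and Jensen's inequality -/

section

variable {H : Type*} [NormedAddCommGroup H] [InnerProductSpace ℂ H] [CompleteSpace H]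

theorem IsStarProjection.conj_nonneg {p A : H →L[ℂ] H} (hp : IsStarProjection p) (hA : 0 ≤ A) :
    0 ≤ p * A * p := by
  have := star_left_conjugate_nonneg hA p
  rwa [hp.isSelfAdjoint.star_eq] at this

theorem IsStarProjection.mul_nonneg_of_comm {p A : H →L[ℂ] H} (hp : IsStarProjection p)
    (hA : 0 ≤ A) (h : p * A = A * p) : 0 ≤ p * A := by
  have := hp.conj_nonneg hA
  rwa [h, mul_assoc, hp.isIdempotentElem.eq, ← h] at this

theorem IsSelfAdjoint.conj_nonneg {K A : H →L[ℂ] H} (hK : IsSelfAdjoint K) (hA : 0 ≤ A) :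
    0 ≤ K * A * K := by
  have := star_left_conjugate_nonneg hA K
  rwa [hK.star_eq] at this

theorem IsSelfAdjoint.conj_le_conj {K A B : H →L[ℂ] H} (hK : IsSelfAdjoint K) (h : A ≤ B) :
    K * A * K ≤ K * B * K := by
  have := star_left_conjugate_le_conjugate h K
  rwa [hK.star_eq] at this

theorem IsSelfAdjoint.real_smul {K : H →L[ℂ] H} (hK : IsSelfAdjoint K) (c : ℝ) :
    IsSelfAdjoint (c • K) := by
  rw [isSelfAdjoint_iff, star_smul, star_trivial, hK.star_eq]

theorem isRegularSublinear_of_regular {F : (H →L[ℂ] H) → (H →L[ℂ] H) → (H →L[ℂ] H)}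
    (hsa : ∀ A B : H →L[ℂ] H, 0 ≤ A → 0 ≤ B → IsSelfAdjoint (F A B))
    (hreg : IsRegularOperatorMap (psdPairs H) F)
    (hhom : ∀ (t : ℝ) (A B : H →L[ℂ] H), 0 < t → 0 ≤ A → 0 ≤ B →
      F (t • A) (t • B) = t • F A B)
    (hconv : ∀ A₁ A₂ B₁ B₂ : H →L[ℂ] H, 0 ≤ A₁ → 0 ≤ A₂ → 0 ≤ B₁ → 0 ≤ B₂ →
      F ((1 / 2 : ℝ) • (A₁ + A₂)) ((1 / 2 : ℝ) • (B₁ + B₂)) ≤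
        (1 / 2 : ℝ) • (F A₁ B₁ + F A₂ B₂))
    (hzero : F 0 0 = 0) : IsRegularSublinear F where
  isSelfAdjoint hA hB := hsa _ _ hA hB
  unitary_map hw hA hB := hreg.unitary_map _ hw _ _ ⟨hA, hB⟩
  smul_map ht hA hB := hhom _ _ _ ht hA hB
  map_zero := hzero
  add_le {A₁ A₂ B₁ B₂} h1 h2 h3 h4 := by
    have h := hconv _ _ _ _ h1 h2 h3 h4
    rw [hhom _ _ _ (by norm_num) (add_nonneg h1 h2) (add_nonneg h3 h4)] at h
    have := smul_le_smul_of_nonneg_left h (zero_le_two (α := ℝ))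
    simpa [smul_smul] using this
  mul_map {p A B} hp hA hB hpA hpB := by
    have hpp : p * p = p := hp.isIdempotentElem
    have block : ∀ {p A B : H →L[ℂ] H}, IsStarProjection p → 0 ≤ A → 0 ≤ B → p * A = A * p →
        p * B = B * p → p * F A B = p * F (p * A) (p * B) * p := by
      intro p A B hp hA hB hpA hpB
      have hpp : p * p = p := hp.isIdempotentElem
      have e : ∀ {X : H →L[ℂ] H}, p * X = X * p → p * X * p = p * X := fun {X} h => by
        rw [h, mul_assoc, hpp]
      have e' : ∀ {X : H →L[ℂ] H}, p * X = X * p → (1 - p) * X * (1 - p) = X - p * X := by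
        intro X h
        simp only [sub_mul, mul_sub, one_mul, mul_one, e h, ← h]
        simp
      have := hreg.block_map p (1 - p) hp hp.one_sub (by simp) A B
        ⟨hp.conj_nonneg hA, hp.conj_nonneg hB⟩
        ⟨hp.one_sub.conj_nonneg hA, hp.one_sub.conj_nonneg hB⟩
      rw [e hpA, e hpB, e' hpA, e' hpB, add_sub_cancel, add_sub_cancel] at this
      have hq : p * (1 - p) = 0 := by rw [mul_sub, hpp, mul_one, sub_self]
      rw [this, mul_add, ← mul_assoc, ← mul_assoc, hpp, ← mul_assoc, ← mul_assoc, hq]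
      simp
    have hA' := hp.mul_nonneg_of_comm hA hpA
    have hB' := hp.mul_nonneg_of_comm hB hpB
    have cA : p * (p * A) = p * A * p := by rw [hpA, mul_assoc A, hpp, ← hpA, ← mul_assoc, hpp]
    have cB : p * (p * B) = p * B * p := by rw [hpB, mul_assoc B, hpp, ← hpB, ← mul_assoc, hpp]
    have h1 := block hp hA' hB' cA cB
    -- On the block `1 - p` the compressed pair is `(0, 0)`, where `F` vanishes, so `F (p * A) (p *
    -- B)` lives in the corner `p`.
    have h2 : (1 - p) * F (p * A) (p * B) = 0 := by
      have := block hp.one_sub hA' hB' (by rw [sub_mul, mul_sub, cA]; simp)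
        (by rw [sub_mul, mul_sub, cB]; simp)
      rw [this]
      simp [sub_mul, ← mul_assoc, hpp, hzero]
    rw [block hp hA hB hpA hpB]
    rw [← mul_assoc p p A, ← mul_assoc p p B, hpp] at h1
    rw [← h1]
    rw [sub_mul, one_mul, sub_eq_zero] at h2
    exact h2.symm

namespace IsRegularSublinear

variable {F : (H →L[ℂ] H) → (H →L[ℂ] H) → (H →L[ℂ] H)} (hF : IsRegularSublinear F)
  {p A B X Y : H →L[ℂ] H}

include hF

theorem map_mul (hp : IsStarProjection p) (hA : 0 ≤ A) (hB : 0 ≤ B) (hpA : p * A = A * p)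
    (hpB : p * B = B * p) : F A B * p = F (p * A) (p * B) := by
  have h := hF.mul_map hp hA hB hpA hpB
  have h' := congrArg star h
  rwa [star_mul, (hF.isSelfAdjoint hA hB).star_eq, hp.isSelfAdjoint.star_eq,
    (hF.isSelfAdjoint (hp.mul_nonneg_of_comm hA hpA) (hp.mul_nonneg_of_comm hB hpB)).star_eq] at h'

theorem commute_map (hp : IsStarProjection p) (hA : 0 ≤ A) (hB : 0 ≤ B) (hpA : p * A = A * p)
    (hpB : p * B = B * p) : p * F A B = F A B * p :=
  (hF.mul_map hp hA hB hpA hpB).trans (hF.map_mul hp hA hB hpA hpB).symm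

/-- With the reflection s = 2p - 1, the sum T + sTs is twice the block diagonal part of T.
Subadditivity and unitary covariance bound F there, and cutting by p gives the claim. -/
theorem map_compress_le (hp : IsStarProjection p) (hX : 0 ≤ X) (hY : 0 ≤ Y) :
    F (p * X * p) (p * Y * p) ≤ p * F X Y * p := by
  have hpp : p * p = p := hp.isIdempotentElem
  have hps : star p = p := hp.isSelfAdjoint
  set s : H →L[ℂ] H := 2 * p - 1 with hs
  have h2 : ∀ T : H →L[ℂ] H, (2 : H →L[ℂ] H) * T = T + T := two_mul
  have hss : star s = s := by simp [hs, h2, hps]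
  have hs1 : s * s = 1 := by
    simp only [hs, h2, mul_sub, sub_mul, mul_add, add_mul, hpp, mul_one, one_mul]; abel
  have hsu : s ∈ unitary (H →L[ℂ] H) := by rw [Unitary.mem_iff, hss]; exact ⟨hs1, hs1⟩
  have hsp : s * p = p := by simp only [hs, h2, sub_mul, add_mul, hpp, one_mul]; abel
  have hps' : p * s = p := by simp only [hs, h2, mul_sub, mul_add, hpp, mul_one]; abel
  have key : ∀ T : H →L[ℂ] H, p * (T + s * T * s) = (2 : ℝ) • (p * T * p) ∧
      (T + s * T * s) * p = (2 : ℝ) • (p * T * p) := by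
    intro T
    constructor
    · rw [two_smul, mul_add, ← mul_assoc, ← mul_assoc, hps', hs]
      simp only [h2, mul_sub, mul_add, mul_one]; abel
    · rw [two_smul, add_mul, mul_assoc (s * T), hsp, hs]
      simp only [h2, sub_mul, add_mul, one_mul]; abel
  have hsX : 0 ≤ s * X * s := IsSelfAdjoint.conj_nonneg hss hX
  have hsY : 0 ≤ s * Y * s := IsSelfAdjoint.conj_nonneg hss hY
  have hu := hF.unitary_map hsu hX hY
  rw [hss] at hu
  have h := hF.add_le hX hsX hY hsY
  rw [hu] at h
  have hc := IsSelfAdjoint.conj_le_conj hp.isSelfAdjoint h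
  rw [(key (F X Y)).1, hF.mul_map hp (add_nonneg hX hsX) (add_nonneg hY hsY)
      ((key X).1.trans (key X).2.symm) ((key Y).1.trans (key Y).2.symm), (key X).1, (key Y).1,
    hF.smul_map two_pos (hp.conj_nonneg hX) (hp.conj_nonneg hY), smul_mul_assoc, smul_mul_assoc,
    mul_assoc (p * F X Y) p p, hpp] at hc
  have hc' := smul_le_smul_of_nonneg_left hc (show (0 : ℝ) ≤ 1 / 2 by norm_num)
  have hcorner : F (p * X * p) (p * Y * p) * p = F (p * X * p) (p * Y * p) := by
    have l : ∀ T : H →L[ℂ] H, p * (p * T * p) = p * T * p := fun T => by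
      rw [← mul_assoc, ← mul_assoc, hpp]
    have r : ∀ T : H →L[ℂ] H, p * T * p * p = p * T * p := fun T => by
      rw [mul_assoc, hpp]
    rw [hF.map_mul hp (hp.conj_nonneg hX) (hp.conj_nonneg hY) (by rw [l, r]) (by rw [l, r]), l, l]
  simpa [smul_smul, hcorner] using hc'

theorem map_conj_le_of_norm_le_one {v K : H →L[ℂ] H} (hp : IsStarProjection p)
    (hv : star v * v = p) (hpv : p * v = 0) (hK : IsSelfAdjoint K) (hK1 : ‖K‖ ≤ 1)
    (hpK : p * K = K) (hA : 0 ≤ A) (hB : 0 ≤ B) (hpA : p * A = A) (hpB : p * B = B) :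
    F (K * A * K) (K * B * K) ≤ K * F A B * K := by
  have hpp : p * p = p := hp.isIdempotentElem
  have hps : star p = p := hp.isSelfAdjoint
  have hAs : star A = A := (IsSelfAdjoint.of_nonneg hA).star_eq
  have hBs : star B = B := (IsSelfAdjoint.of_nonneg hB).star_eq
  have hKs : star K = K := hK.star_eq
  have hAp : A * p = A := by simpa [hAs, hps] using congrArg star hpA
  have hBp : B * p = B := by simpa [hBs, hps] using congrArg star hpB
  obtain ⟨U, hU, hUK⟩ := exists_dilation hp hv hpv hK hpK hK1
  have hUK' : p * star U * p = K := by
    have := congrArg star hUK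
    rwa [star_mul, star_mul, hps, hKs, ← mul_assoc] at this
  have e : ∀ T : H →L[ℂ] H, p * T = T → T * p = T → p * (star U * T * U) * p = K * T * K := by
    intro T h1 h2
    have : p * (star U * T * U) * p = (p * star U * p) * T * (p * U * p) := by
      conv_lhs => rw [← h1, ← h2]
      simp only [mul_assoc]
    rw [this, hUK, hUK']
  have h1 := hF.mul_map hp hA hB (hpA.trans hAp.symm) (hpB.trans hBp.symm)
  have h2 := hF.map_mul hp hA hB (hpA.trans hAp.symm) (hpB.trans hBp.symm)
  rw [hpA, hpB] at h1 h2
  have h := hF.map_compress_le hp (star_left_conjugate_nonneg hA U)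
    (star_left_conjugate_nonneg hB U)
  rwa [hF.unitary_map hU hA hB, e _ hpA hAp, e _ hpB hBp, e _ h1 h2] at h

/-- Jensen's inequality on a corner that embeds into its complement. -/
theorem map_conj_le {v K : H →L[ℂ] H} (hp : IsStarProjection p) (hv : star v * v = p)
    (hpv : p * v = 0) (hK : IsSelfAdjoint K) (hpK : p * K = K) (hA : 0 ≤ A) (hB : 0 ≤ B)
    (hpA : p * A = A) (hpB : p * B = B) : F (K * A * K) (K * B * K) ≤ K * F A B * K := by
  -- Both sides scale by `c * c` when `K` is replaced by `c • K`, so a contraction suffices.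
  obtain ⟨c, hc0, hc1⟩ : ∃ c : ℝ, 0 < c ∧ c * ‖K‖ ≤ 1 := by
    refine ⟨(‖K‖ + 1)⁻¹, by positivity, ?_⟩
    rw [inv_mul_le_one₀ (by positivity)]
    linarith
  have hcK : IsSelfAdjoint (c • K) := hK.real_smul c
  have h := hF.map_conj_le_of_norm_le_one hp hv hpv hcK
    (by rwa [norm_smul, Real.norm_of_nonneg hc0.le]) (by rw [mul_smul_comm, hpK]) hA hB hpA hpB
  simp only [smul_mul_assoc, mul_smul_comm, smul_smul] at h
  have hcc : 0 < c * c := mul_pos hc0 hc0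
  rw [hF.smul_map hcc (hK.conj_nonneg hA) (hK.conj_nonneg hB)] at h
  have h' := smul_le_smul_of_nonneg_left h (inv_nonneg.2 hcc.le)
  rwa [smul_smul, smul_smul, inv_mul_cancel₀ hcc.ne', one_smul, one_smul] at h'

end IsRegularSublinear

end

/-! ### Bernstein partitions of unity -/

section Weights

/-- Bernstein polynomials reproduce constants and the identity exactly and approximate `f`
uniformly. The exactness allows both operators to be split without error. -/
theorem exists_bernstein_weights {f : ℝ → ℝ} (hf : Continuous f) {a b ε : ℝ} (ha : 0 < a)
    (hb : 0 < b) (hε : 0 < ε) :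
    ∃ (n : ℕ) (d : Fin n → ℝ) (w : Fin n → ℝ → ℝ), (∀ k, 0 ≤ d k) ∧ (∀ k, Continuous (w k)) ∧
      ∀ t ∈ Set.Icc a b, (∀ k, 0 < w k t) ∧ ∑ k, w k t = 1 ∧ ∑ k, d k * w k t = t ∧
        |∑ k, f (d k) * w k t - f t| ≤ ε := by
  -- `R > b` and `a > 0` keep `t / R` strictly inside the unit interval, so every weight is strictly
  -- positive. The nodes include 0.
  set R : ℝ := b + 1 with hR
  have hR0 : 0 < R := by positivity
  let g : C(unitInterval, ℝ) := ⟨fun x => f (R * x), by fun_prop⟩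
  obtain ⟨n, hn, hn0⟩ := ((Metric.tendsto_nhds.1 (bernsteinApproximation_uniform g) ε hε).and
    (eventually_gt_atTop 0)).exists
  refine ⟨n + 1, fun k => R * (k / n), fun k t => (bernsteinPolynomial ℝ n k).eval (t / R),
    fun k => by positivity, fun k => by fun_prop, fun t ht => ?_⟩
  have hn' : (n : ℝ) ≠ 0 := by positivity
  have ht0 : 0 < t := ha.trans_le ht.1
  have h0 : 0 < t / R := by positivity
  have h1 : t / R < 1 := by rw [div_lt_one hR0]; linarith [ht.2]
  refine ⟨fun k => ?_, ?_, ?_, ?_⟩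
  · have hk : (k : ℕ) ≤ n := Nat.lt_succ_iff.1 k.2
    have : (0 : ℝ) < n.choose k := by exact_mod_cast Nat.choose_pos hk
    have h2 : 0 < 1 - t / R := by linarith
    simp only [bernsteinPolynomial, Polynomial.eval_mul, Polynomial.eval_natCast,
      Polynomial.eval_pow, Polynomial.eval_X, Polynomial.eval_sub, Polynomial.eval_one]
    positivity
  · have := congrArg (Polynomial.eval (t / R)) (bernsteinPolynomial.sum ℝ n)
    rw [Polynomial.eval_finsetSum, Finset.sum_range] at this
    simpa using this
  · have := congrArg (Polynomial.eval (t / R)) (bernsteinPolynomial.sum_smul ℝ n)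
    rw [Polynomial.eval_finsetSum, Finset.sum_range] at this
    simp only [nsmul_eq_mul, Polynomial.eval_mul, Polynomial.eval_natCast, Polynomial.eval_X] at this
    have e : ∑ k : Fin (n + 1), R * ((k : ℕ) / n) * (bernsteinPolynomial ℝ n k).eval (t / R) =
        R / n * ∑ k : Fin (n + 1), (k : ℕ) * (bernsteinPolynomial ℝ n k).eval (t / R) := by
      rw [Finset.mul_sum]
      exact Finset.sum_congr rfl fun k _ => by ring
    rw [e, this]
    field_simp
  · have hle := ((ContinuousMap.dist_lt_iff hε).1 hn ⟨t / R, h0.le, h1.le⟩).le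
    rw [bernsteinApproximation.apply, Real.dist_eq] at hle
    have e1 : g ⟨t / R, h0.le, h1.le⟩ = f t := by
      change f (R * (t / R)) = f t
      rw [mul_div_cancel₀ _ hR0.ne']
    rw [e1] at hle
    refine le_of_eq_of_le ?_ hle
    congr 2
    refine Finset.sum_congr rfl fun k _ => ?_
    rw [smul_eq_mul, mul_comm]
    rfl

end Weights

/-! ### Strong limits of finite-dimensional compressions -/

section StrongLimits

variable {H : Type*} [NormedAddCommGroup H] [InnerProductSpace ℂ H] [CompleteSpace H]

theorem tendsto_apply_of_norm_le {ι E : Type*} [NormedAddCommGroup E] [NormedSpace ℂ E]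
    {l : Filter ι} {S : ι → E →L[ℂ] E} {S₀ : E →L[ℂ] E} {M : ℝ}
    (hM : ∀ i, ‖S i‖ ≤ M) (hS : ∀ η, Tendsto (fun i => S i η) l (𝓝 (S₀ η))) {x : ι → E} {x₀ : E}
    (hx : Tendsto x l (𝓝 x₀)) : Tendsto (fun i => S i (x i)) l (𝓝 (S₀ x₀)) := by
  have h1 : Tendsto (fun i => S i (x i - x₀)) l (𝓝 0) := by
    have h2 : Tendsto (fun i => M * ‖x i - x₀‖) l (𝓝 0) := by
      simpa using (tendsto_iff_norm_sub_tendsto_zero.1 hx).const_mul M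
    exact squeeze_zero_norm (fun i => ContinuousLinearMap.le_of_opNorm_le _ (hM i) _) h2
  simpa using h1.add (hS x₀)

theorem exists_norm_cfc_le (H : Type*) [NormedAddCommGroup H] [InnerProductSpace ℂ H]
    [CompleteSpace H] {a b : ℝ} {g : ℝ → ℝ} (hg : ContinuousOn g (Set.Icc a b)) :
    ∃ C, ∀ T : H →L[ℂ] H, spectrum ℝ T ⊆ Set.Icc a b → ‖cfc g T‖ ≤ C := by
  obtain ⟨C, hC⟩ := isCompact_Icc.exists_bound_of_continuousOn hg
  exact ⟨max C 0, fun T hT => norm_cfc_le (le_max_right _ _) fun x hx =>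
    (hC x (hT hx)).trans (le_max_left _ _)⟩

theorem spectrum_subset_Icc_of_norm_le {T : H →L[ℂ] H} (hT : IsSelfAdjoint T) {M : ℝ}
    (hM : ‖T‖ ≤ M) : spectrum ℝ T ⊆ Set.Icc (-M) M := by
  have h1 := hT.le_algebraMap_norm_self
  have h2 := hT.neg_algebraMap_norm_le_self
  rw [← map_neg] at h2
  intro x hx
  exact ⟨(neg_le_neg hM).trans ((algebraMap_le_iff_le_spectrum (ha := hT)).1 h2 x hx),
    ((le_algebraMap_iff_spectrum_le (ha := hT)).1 h1 x hx).trans hM⟩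

theorem IsStarProjection.compress_add_bounds {p T : H →L[ℂ] H} (hp : IsStarProjection p) {a b : ℝ}
    (ha : a • 1 ≤ T) (hb : T ≤ b • 1) (ha1 : a ≤ 1) (hb1 : 1 ≤ b) :
    a • 1 ≤ p * T * p + (1 - p) ∧ p * T * p + (1 - p) ≤ b • 1 := by
  have e : ∀ c : ℝ, p * (c • (1 : H →L[ℂ] H)) * p + c • (1 - p) = c • 1 := by
    intro c
    rw [mul_smul_comm, smul_mul_assoc, mul_one, hp.isIdempotentElem.eq, ← smul_add,
      add_sub_cancel]
  have hq : 0 ≤ 1 - p := hp.one_sub.nonneg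
  have m : ∀ {c d : ℝ}, c ≤ d → c • (1 - p) ≤ d • (1 - p) := fun h =>
    smul_le_smul_of_nonneg_right h hq
  constructor
  · rw [← e a]
    refine add_le_add (hp.isSelfAdjoint.conj_le_conj ha) ?_
    simpa using m ha1
  · rw [← e b]
    refine add_le_add (hp.isSelfAdjoint.conj_le_conj hb) ?_
    simpa using m hb1

theorem eventually_starProjection_span_eq {H : Type*} [NormedAddCommGroup H]
    [InnerProductSpace ℂ H] (ξ : H) :
    ∀ᶠ s : Finset H in atTop, (Submodule.span ℂ (s : Set H)).starProjection ξ = ξ := by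
  filter_upwards [eventually_ge_atTop {ξ}] with s hs
  exact Submodule.starProjection_eq_self_iff.2
    (Submodule.subset_span (by simpa using hs))

/-- The net is eventually constant: once the span contains `η` and `T η`, the compression agrees
with `T` at `η`. -/
theorem tendsto_compress_add {H : Type*} [NormedAddCommGroup H] [InnerProductSpace ℂ H]
    (T : H →L[ℂ] H) (η : H) :
    Tendsto (fun s : Finset H => ((Submodule.span ℂ (s : Set H)).starProjection * T *
      (Submodule.span ℂ (s : Set H)).starProjection +
      (1 - (Submodule.span ℂ (s : Set H)).starProjection)) η) atTop (𝓝 (T η)) := by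
  refine tendsto_const_nhds.congr' ?_
  filter_upwards [eventually_starProjection_span_eq η, eventually_starProjection_span_eq (T η)]
    with s h1 h2
  simp [h1, h2]

end StrongLimits

/-! ### Square roots of invertible positive operators -/

section Roots

variable {H : Type*} [NormedAddCommGroup H] [InnerProductSpace ℂ H] [CompleteSpace H]
  {T : H →L[ℂ] H}

theorem isSelfAdjoint_rpow (T : H →L[ℂ] H) (y : ℝ) : IsSelfAdjoint (T ^ y) :=
  .of_nonneg CFC.rpow_nonneg

theorem IsStrictlyPositive.rpow_half_mul_self (hT : IsStrictlyPositive T) :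
    T ^ (1 / 2 : ℝ) * T ^ (1 / 2 : ℝ) = T := by
  rw [← CFC.rpow_add hT.isUnit]
  norm_num
  exact CFC.rpow_one T hT.nonneg

theorem IsStrictlyPositive.rpow_half_mul_rpow_neg_half (hT : IsStrictlyPositive T) :
    T ^ (1 / 2 : ℝ) * T ^ (-(1 / 2) : ℝ) = 1 := CFC.rpow_mul_rpow_neg _ hT

theorem IsStrictlyPositive.rpow_neg_half_mul_rpow_half (hT : IsStrictlyPositive T) :
    T ^ (-(1 / 2) : ℝ) * T ^ (1 / 2 : ℝ) = 1 := CFC.rpow_neg_mul_rpow _ hT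

theorem IsStrictlyPositive.rpow_neg_half_conj (hT : IsStrictlyPositive T) :
    T ^ (-(1 / 2) : ℝ) * T * T ^ (-(1 / 2) : ℝ) = 1 := by
  conv_lhs => enter [1, 2]; rw [← hT.rpow_half_mul_self]
  rw [← mul_assoc, hT.rpow_neg_half_mul_rpow_half, one_mul, hT.rpow_half_mul_rpow_neg_half]

theorem IsStrictlyPositive.conj {A B : H →L[ℂ] H} (hA : IsUnit A) (hAs : IsSelfAdjoint A)
    (hB : IsStrictlyPositive B) : IsStrictlyPositive (A * B * A) := by
  refine ⟨hAs.conj_nonneg hB.nonneg, (hA.mul hB.isUnit).mul hA⟩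

end Roots

/-! ### The scalar function and its action on finite-dimensional corners -/

namespace IsRegularSublinear

variable {H : Type*} [NormedAddCommGroup H] [InnerProductSpace ℂ H] [CompleteSpace H]
  {F : (H →L[ℂ] H) → (H →L[ℂ] H) → (H →L[ℂ] H)} (hF : IsRegularSublinear F)
  {p A B X Y : H →L[ℂ] H}

include hF

/-- Commuting with each rank-one projection makes every vector an eigenvector, so the value is
scalar; self-adjointness makes the scalar real. -/
theorem exists_map_one_eq_smul (hA : 0 ≤ A) (hB : 0 ≤ B)
    (hA' : ∀ p : H →L[ℂ] H, p * A = A * p) (hB' : ∀ p : H →L[ℂ] H, p * B = B * p) :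
    ∃ c : ℝ, F A B = c • 1 := by
  obtain ⟨c, hc⟩ : ∃ c : ℂ, ((F A B : H →L[ℂ] H) : H →ₗ[ℂ] H) = c • 1 := by
    refine LinearMap.exists_eq_smul_id_of_forall_notLinearIndependent fun ξ => ?_
    have h := hF.commute_map (p := (ℂ ∙ ξ).starProjection) isStarProjection_starProjection hA hB
      (hA' _) (hB' _)
    have h1 := DFunLike.congr_fun h ξ
    simp only [ContinuousLinearMap.mul_def, ContinuousLinearMap.comp_apply] at h1
    rw [Submodule.starProjection_eq_self_iff.2 (Submodule.mem_span_singleton_self ξ),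
      Submodule.starProjection_eq_self_iff] at h1
    obtain ⟨a, ha⟩ := Submodule.mem_span_singleton.1 h1
    rw [LinearIndependent.pair_iff]
    intro hli
    have := (hli a (-1) (by simp [ha])).2
    simp at this
  have hc' : F A B = c • 1 := by
    ext ξ
    exact LinearMap.congr_fun hc ξ
  rcases subsingleton_or_nontrivial H with hH | hH
  · exact ⟨0, Subsingleton.elim _ _⟩
  refine ⟨c.re, ?_⟩
  have hs := (hF.isSelfAdjoint hA hB).star_eq
  rw [hc', star_smul, star_one] at hs
  have hcc : star c = c := by
    have : (star c - c) • (1 : H →L[ℂ] H) = 0 := by rw [sub_smul, hs, sub_self]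
    exact sub_eq_zero.1 ((smul_eq_zero.1 this).resolve_right one_ne_zero)
  rw [hc']
  conv_lhs => rw [← Complex.conj_eq_iff_re.1 hcc]
  ext ξ
  simp

theorem exists_scalar_function [Nontrivial H]
    (hcont : StronglyContinuousOnBounded (fun B => F 1 B) {B : H →L[ℂ] H | 0 ≤ B}) :
    ∃ f : ℝ → ℝ, Continuous f ∧ ∀ t : ℝ, 0 ≤ t → F 1 (t • 1) = f t • 1 := by
  -- Truncating at 0 extends `f` continuously to the whole line.
  have key : ∀ t : ℝ, ∃ c : ℝ, F 1 (max t 0 • 1) = c • 1 := fun t =>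
    hF.exists_map_one_eq_smul zero_le_one (smul_nonneg (le_max_right _ _) zero_le_one)
      (by simp) (by simp)
  choose f hf using key
  refine ⟨f, ?_, fun t ht => by have := hf t; rwa [max_eq_left ht] at this⟩
  obtain ⟨ξ, hξ⟩ := exists_ne (0 : H)
  have main : ∀ R : ℝ, ContinuousOn (fun t => f t • ξ) (Set.Iio R) := by
    intro R
    have h1 := hcont ((fun t : ℝ => max t 0 • (1 : H →L[ℂ] H)) '' Set.Iio R)
      (by rintro _ ⟨t, -, rfl⟩; exact smul_nonneg (le_max_right t 0) (zero_le_one' (H →L[ℂ] H))) (by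
        rw [isBounded_iff_forall_norm_le]
        refine ⟨max R 0 * ‖(1 : H →L[ℂ] H)‖, ?_⟩
        rintro _ ⟨t, ht, rfl⟩
        rw [norm_smul, Real.norm_of_nonneg (le_max_right _ _)]
        gcongr
        exact (Set.mem_Iio.1 ht).le)
    have hev : ∀ η : H, @Continuous _ _ (strongOperatorTopology H) _
        (fun T : H →L[ℂ] H => T η) := by
      intro η
      let _ := strongOperatorTopology H
      have h2 : Continuous (ContinuousLinearMap.toPointwiseConvergenceCLM ℂ (RingHom.id ℂ) H H) :=
        continuous_induced_dom
      exact (PointwiseConvergenceCLM.evalCLM (RingHom.id ℂ) H η).continuous.comp h2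
    have hin : @Continuous _ _ _ (strongOperatorTopology H)
        (fun t : ℝ => max t 0 • (1 : H →L[ℂ] H)) := by
      rw [continuous_induced_rng]
      refine (ContinuousLinearMap.toPointwiseConvergenceCLM ℂ (RingHom.id ℂ) H H).continuous.comp ?_
      fun_prop
    have h3 := @ContinuousOn.comp _ _ _ _ (strongOperatorTopology H) (strongOperatorTopology H)
      _ _ _ _ h1 (@Continuous.continuousOn _ _ _ (strongOperatorTopology H) _ (Set.Iio R) hin)
      (Set.mapsTo_image _ _)
    have h4 := @Continuous.comp_continuousOn _ _ _ _ (strongOperatorTopology H) _ _ _ _ (hev ξ) h3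
    refine h4.congr fun t _ => ?_
    simp [hf t]
  have hc : Continuous (fun t => f t • ξ) := by
    rw [continuous_iff_continuousAt]
    exact fun t => (main (t + 1)).continuousAt (Iio_mem_nhds (by linarith))
  have hc' : Continuous fun t => (inner ℂ ξ (f t • ξ) : ℂ).re / ‖ξ‖ ^ 2 := by fun_prop
  refine hc'.congr fun t => ?_
  have : (inner ℂ ξ (f t • ξ) : ℂ) = ((f t * ‖ξ‖ ^ 2 : ℝ) : ℂ) := by
    rw [← Complex.coe_smul, inner_smul_right, inner_self_eq_norm_sq_to_K]
    simp
  rw [this, Complex.ofReal_re, mul_div_cancel_right₀ _ (by simpa using hξ)]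

variable {f : ℝ → ℝ} (hf : ∀ t : ℝ, 0 ≤ t → F 1 (t • 1) = f t • 1)

include hf

theorem map_projection (hp : IsStarProjection p) {t : ℝ} (ht : 0 ≤ t) :
    F p (t • p) = f t • p := by
  have h := hF.mul_map hp zero_le_one (smul_nonneg ht zero_le_one) (by simp) (by simp)
  rw [hf t ht] at h
  simpa using h.symm

theorem map_one_mul_of_mul_eq_smul (hp : IsStarProjection p) {t : ℝ} (ht : 0 ≤ t) (hY : 0 ≤ Y)
    (hY' : Y * p = t • p) : F 1 Y * p = f t • p := by
  have h : p * Y = t • p := by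
    have := congrArg star hY'
    rwa [star_mul, (IsSelfAdjoint.of_nonneg hY).star_eq, star_smul, hp.isSelfAdjoint.star_eq,
      star_trivial] at this
  rw [hF.map_mul hp zero_le_one hY (by simp) (h.trans hY'.symm), mul_one, h,
    hF.map_projection hf hp ht]

theorem map_one_apply_of_eigenvector {t : ℝ} (hY : 0 ≤ Y) {ξ : H} (h : Y ξ = t • ξ) :
    F 1 Y ξ = f t • ξ := by
  rcases eq_or_ne ξ 0 with rfl | hξ
  · simp
  have ht : 0 ≤ t := by
    have h1 := ((ContinuousLinearMap.nonneg_iff_isPositive Y).1 hY).re_inner_nonneg_left ξ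
    rw [h, ← Complex.coe_smul, inner_smul_left, inner_self_eq_norm_sq_to_K] at h1
    have h2 : 0 ≤ t * ‖ξ‖ ^ 2 := by simpa [← Complex.ofReal_pow] using h1
    exact nonneg_of_mul_nonneg_left h2 (by positivity)
  have h1 := hF.map_one_mul_of_mul_eq_smul hf (p := (ℂ ∙ ξ).starProjection) (t := t)
    isStarProjection_starProjection ht hY (by
      ext η
      obtain ⟨c, hc⟩ := Submodule.mem_span_singleton.1
        ((ℂ ∙ ξ).starProjection_apply_mem η)
      simp [← hc, h, smul_comm c t])
  have h2 := DFunLike.congr_fun h1 ξ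
  have h3 : (ℂ ∙ ξ).starProjection ξ = ξ :=
    Submodule.starProjection_eq_self_iff.2 (Submodule.mem_span_singleton_self ξ)
  simpa [h3] using h2

/-- `Y` restricted to `E` has an orthonormal eigenbasis, and both operators multiply an eigenvector
of eigenvalue `t` by `f t`. -/
theorem map_one_mul_eq_cfc_mul (hfc : Continuous f) (E : Submodule ℂ H) [FiniteDimensional ℂ E]
    (hY : 0 ≤ Y) (hEY : E.starProjection * Y = Y * E.starProjection) :
    F 1 Y * E.starProjection = cfc f Y * E.starProjection := by
  have hYs : IsSelfAdjoint Y := .of_nonneg hY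
  have hinv : ∀ ξ ∈ E, (Y : H →ₗ[ℂ] H) ξ ∈ E := by
    intro ξ hξ
    have := DFunLike.congr_fun hEY ξ
    simp only [ContinuousLinearMap.mul_def, ContinuousLinearMap.comp_apply] at this
    rw [Submodule.starProjection_eq_self_iff.2 hξ, Submodule.starProjection_eq_self_iff] at this
    exact this
  have hsym : ((Y : H →ₗ[ℂ] H).restrict hinv).IsSymmetric :=
    (ContinuousLinearMap.isSelfAdjoint_iff_isSymmetric.1 hYs).restrict_invariant hinv
  let b := hsym.eigenvectorBasis rfl
  have hb : ∀ i, Y (b i : H) = hsym.eigenvalues rfl i • (b i : H) := by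
    intro i
    have := congrArg Subtype.val (hsym.apply_eigenvectorBasis rfl i)
    rwa [Submodule.coe_smul, LinearMap.coe_restrict_apply] at this
  have heq : (F 1 Y : H →ₗ[ℂ] H) ∘ₗ E.subtype = (cfc f Y : H →L[ℂ] H) ∘ₗ E.subtype := by
    refine b.toBasis.ext fun i => ?_
    simp only [OrthonormalBasis.coe_toBasis, LinearMap.comp_apply, Submodule.subtype_apply,
      ContinuousLinearMap.coe_coe]
    rw [hF.map_one_apply_of_eigenvector hf hY (hb i), cfc_apply_of_eigenvector hfc hYs (hb i)]
  ext η
  exact LinearMap.congr_fun heq ⟨_, E.starProjection_apply_mem η⟩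

/-- Jensen with `P * L` moves the compressed pair to `(P, P * D)`, where `F` is known. Conjugating
back by `K`, the inverse of `L`, and then using `map_compress_le` gives the bound. -/
theorem conj_cfc_mul_le_compress (hdim : ¬ FiniteDimensional ℂ H) (hfc : Continuous f)
    (E : Submodule ℂ H) [FiniteDimensional ℂ E] {K L D X' Y' : H →L[ℂ] H}
    (hX : 0 ≤ X) (hY : 0 ≤ Y) (hY' : 0 ≤ Y')
    (hK : IsSelfAdjoint K) (hL : IsSelfAdjoint L) (hKL : K * L = 1) (hLK : L * K = 1)
    (hKE : Commute K E.starProjection) (hKX : K * K = X')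
    (hEX : E.starProjection * X' = E.starProjection * X * E.starProjection)
    (hYE : Commute Y' E.starProjection)
    (hEY : E.starProjection * Y' = E.starProjection * Y * E.starProjection)
    (hD : D = L * Y' * L) :
    K * (cfc f D * E.starProjection) * K ≤ E.starProjection * F X Y * E.starProjection := by
  set P := E.starProjection with hPdef
  have hP : IsStarProjection P := isStarProjection_starProjection
  have hPP : P * P = P := hP.isIdempotentElem
  have hLE : P * L = L * P := by
    calc P * L = L * K * (P * L) := by rw [hLK, one_mul]
      _ = L * (K * P) * L := by simp only [mul_assoc]
      _ = L * P * (K * L) := by rw [hKE.eq]; simp only [mul_assoc]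
      _ = L * P := by rw [hKL, mul_one]
  obtain ⟨v, hv, hPv⟩ := exists_partialIsometry_orthogonal hdim E
  have hD0 : 0 ≤ D := hD ▸ hL.conj_nonneg hY'
  have hDP : P * D = D * P := by
    rw [hD]
    calc P * (L * Y' * L) = (P * L) * Y' * L := by simp only [mul_assoc]
      _ = L * (P * Y') * L := by rw [hLE]; simp only [mul_assoc]
      _ = L * Y' * (P * L) := by rw [← hYE.eq]; simp only [mul_assoc]
      _ = L * Y' * L * P := by rw [hLE]; simp only [mul_assoc]
  have hPL : IsSelfAdjoint (P * L) := by
    rw [isSelfAdjoint_iff, star_mul, hL.star_eq, hP.isSelfAdjoint.star_eq, hLE]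
  have pc : ∀ T : H →L[ℂ] H, P * (P * T * P) = P * T * P := fun T => by
    rw [← mul_assoc, ← mul_assoc, hPP]
  have h1 := hF.map_conj_le hP hv hPv hPL (by rw [← mul_assoc, hPP])
    (hP.conj_nonneg hX) (hP.conj_nonneg hY) (pc X) (pc Y)
  have e : ∀ T : H →L[ℂ] H, P * T * P = P * T → P * L * (P * T) * (P * L) = P * (L * T * L) := by
    intro T hT
    calc P * L * (P * T) * (P * L) = (P * L) * (P * T * P) * L := by simp only [mul_assoc]
      _ = P * (L * P) * T * L := by rw [hT]; simp only [mul_assoc]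
      _ = (P * P) * L * T * L := by rw [← hLE]; simp only [mul_assoc]
      _ = P * (L * T * L) := by rw [hPP]; simp only [mul_assoc]
  have cX : P * X' * P = P * X' := by rw [hEX, mul_assoc (P * X), hPP]
  have cY : P * Y' * P = P * Y' := by rw [hEY, mul_assoc (P * Y), hPP]
  rw [← hEX, ← hEY, e _ cX, e _ cY, ← hD, ← hKX, ← mul_assoc L, hLK, one_mul, hKL] at h1
  have h2 : F (P * 1) (P * D) = cfc f D * P := by
    rw [← hF.map_mul hP zero_le_one hD0 (by simp) hDP,
      hF.map_one_mul_eq_cfc_mul hf hfc E hD0 hDP]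
  rw [h2] at h1
  have h3 := hK.conj_le_conj h1
  have hX0 : 0 ≤ P * (K * K) := by rw [hKX, hEX]; exact hP.conj_nonneg hX
  have hY0 : 0 ≤ P * Y' := by rw [hEY]; exact hP.conj_nonneg hY
  have e1 : P * (K * K) * P = P * (K * K) := by rw [hKX, cX]
  have hKP : K * (P * L) = P := by rw [← mul_assoc, hKE.eq, mul_assoc, hKL, mul_one]
  have hKP' : P * L * K = P := by rw [mul_assoc, hLK, mul_one]
  have h4 : K * (P * L * F (P * (K * K)) (P * Y') * (P * L)) * K =
      P * F (P * (K * K)) (P * Y') * P := by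
    calc _ = (K * (P * L)) * F (P * (K * K)) (P * Y') * (P * L * K) := by simp only [mul_assoc]
      _ = _ := by rw [hKP, hKP']
  rw [h4] at h3
  refine h3.trans ?_
  have h5 := hP.isSelfAdjoint.conj_le_conj (hF.map_compress_le hP hX hY)
  rw [← hEX, ← hEY, ← hKX] at h5
  rwa [pc, mul_assoc (P * F X Y), hPP] at h5

end IsRegularSublinear

/-! ### A unitary equivalence from polar decomposition -/

section Polar

variable {H : Type*} [NormedAddCommGroup H] [InnerProductSpace ℂ H] [CompleteSpace H]

theorem IsStrictlyPositive.exists_smul_one_le {T : H →L[ℂ] H} (hT : IsStrictlyPositive T) :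
    ∃ a b : ℝ, 0 < a ∧ a ≤ 1 ∧ 1 ≤ b ∧ a • 1 ≤ T ∧ T ≤ b • 1 ∧ spectrum ℝ T ⊆ Set.Icc a b := by
  obtain ⟨a, b, h0, h1, h2, h⟩ := hT.exists_spectrum_subset_Icc
  have := smul_one_le_of_spectrum_subset (IsSelfAdjoint.of_nonneg hT.nonneg) h
  exact ⟨a, b, h0, h1, h2, this.1, this.2, h⟩

theorem IsStrictlyPositive.isometry_conj {T V : H →L[ℂ] H} (hT : IsStrictlyPositive T)
    (hV : star V * V = 1) : IsStrictlyPositive (star V * T * V) := by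
  obtain ⟨a, -, h0, -, -, h, -⟩ := hT.exists_smul_one_le
  have := star_left_conjugate_le_conjugate h V
  rw [mul_smul_comm, smul_mul_assoc, mul_one, hV] at this
  exact isStrictlyPositive_of_smul_one_le h0 this

theorem IsStrictlyPositive.rpow_half_isUnit {T : H →L[ℂ] H} (hT : IsStrictlyPositive T) :
    IsUnit (T ^ (1 / 2 : ℝ)) :=
  ⟨⟨_, _, hT.rpow_half_mul_rpow_neg_half, hT.rpow_neg_half_mul_rpow_half⟩, rfl⟩

theorem IsStrictlyPositive.rpow_neg_half_isUnit {T : H →L[ℂ] H} (hT : IsStrictlyPositive T) :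
    IsUnit (T ^ (-(1 / 2) : ℝ)) :=
  ⟨⟨_, _, hT.rpow_neg_half_mul_rpow_half, hT.rpow_half_mul_rpow_neg_half⟩, rfl⟩

/-- For invertible positive `M` and complementary isometries `V₁`, `V₂`, the operators
`M ^ (1/2) V₁ V₁* M ^ (1/2)` and `V₁ V₁* M V₁ V₁*` are unitarily equivalent. -/
theorem exists_unitary_conj_range_projection {V₁ V₂ M : H →L[ℂ] H} (h1 : star V₁ * V₁ = 1)
    (h2 : star V₂ * V₂ = 1) (h12 : star V₁ * V₂ = 0) (h21 : star V₂ * V₁ = 0)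
    (hV : V₁ * star V₁ + V₂ * star V₂ = 1) (hM : IsStrictlyPositive M) :
    ∃ w ∈ unitary (H →L[ℂ] H), star w * (V₁ * (star V₁ * M * V₁) * star V₁) * w =
      M ^ (1 / 2 : ℝ) * (V₁ * star V₁) * M ^ (1 / 2 : ℝ) := by
  set X := M ^ (1 / 2 : ℝ) with hXdef
  set Z := M ^ (-(1 / 2) : ℝ) with hZdef
  have hX : star X = X := isSelfAdjoint_rpow M _
  have hZ : star Z = Z := isSelfAdjoint_rpow M _
  have hXZ : X * Z = 1 := hM.rpow_half_mul_rpow_neg_half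
  have hZX : Z * X = 1 := hM.rpow_neg_half_mul_rpow_half
  have hXX : X * X = M := hM.rpow_half_mul_self
  have hZZ : IsStrictlyPositive (Z * Z) := by
    have := IsStrictlyPositive.conj hM.rpow_neg_half_isUnit (isSelfAdjoint_rpow M _)
      (isStrictlyPositive_one (A := H →L[ℂ] H))
    rwa [mul_one] at this
  have ha : IsStrictlyPositive (star V₁ * M * V₁) := hM.isometry_conj h1
  have hb : IsStrictlyPositive (star V₂ * (Z * Z) * V₂) := hZZ.isometry_conj h2
  set a := star V₁ * M * V₁ with hadef
  set b := star V₂ * (Z * Z) * V₂ with hbdef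
  set α := a ^ (-(1 / 2) : ℝ) with hαdef
  set α' := a ^ (1 / 2 : ℝ) with hα'def
  set β := b ^ (-(1 / 2) : ℝ) with hβdef
  set β' := b ^ (1 / 2 : ℝ) with hβ'def
  have hα : star α = α := isSelfAdjoint_rpow a _
  have hβ : star β = β := isSelfAdjoint_rpow b _
  have haa : α * a * α = 1 := ha.rpow_neg_half_conj
  have hbb : β * b * β = 1 := hb.rpow_neg_half_conj
  have hα' : α' * α = 1 := ha.rpow_half_mul_rpow_neg_half
  have hβ' : β' * β = 1 := hb.rpow_half_mul_rpow_neg_half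
  have tr : ∀ {a b c : H →L[ℂ] H}, a * b = c → ∀ x, a * (b * x) = c * x := fun h x => by
    rw [← mul_assoc, h]
  -- Polar parts of `star V₁ * X` and `star V₂ * Z`. They are coisometries, with orthogonal initial
  -- spaces because `X * Z = 1` and `star V₁ * V₂ = 0`.
  set W₁ := α * star V₁ * X with hW₁
  set W₂ := β * star V₂ * Z with hW₂
  have sW₁ : star W₁ = X * V₁ * α := by simp [hW₁, hX, hα, mul_assoc]
  have sW₂ : star W₂ = Z * V₂ * β := by simp [hW₂, hZ, hβ, mul_assoc]
  clear_value W₁ W₂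
  have e11 : W₁ * star W₁ = 1 := by
    rw [sW₁, hW₁, ← haa, hadef, ← hXX]; simp only [mul_assoc]
  have e22 : W₂ * star W₂ = 1 := by
    rw [sW₂, hW₂, ← hbb, hbdef]; simp only [mul_assoc]
  have e12 : W₁ * star W₂ = 0 := by
    rw [sW₂, hW₁]
    simp only [mul_assoc, tr hXZ, one_mul, tr h12, zero_mul, mul_zero]
  have e21 : W₂ * star W₁ = 0 := by simpa using congrArg star e12
  have hR : star W₁ * W₁ + star W₂ * W₂ = 1 := by
    -- Being killed by `W₁` forces `X * R` into the range of `V₂`; being killed by `W₂` then gives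
    -- `b * (star V₂ * (X * R)) = 0`, and `b` is invertible.
    set R := 1 - (star W₁ * W₁ + star W₂ * W₂) with hRdef
    have r1 : W₁ * R = 0 := by
      rw [hRdef, mul_sub, mul_add, ← mul_assoc, ← mul_assoc, e11, e12]; simp
    have r2 : W₂ * R = 0 := by
      rw [hRdef, mul_sub, mul_add, ← mul_assoc, ← mul_assoc, e21, e22]; simp
    have r1' : star V₁ * (X * R) = 0 := by
      have := congrArg (α' * ·) r1
      simpa only [hW₁, mul_assoc, tr hα', one_mul, mul_zero] using this
    have r2' : star V₂ * (Z * R) = 0 := by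
      have := congrArg (β' * ·) r2
      simpa only [hW₂, mul_assoc, tr hβ', one_mul, mul_zero] using this
    have r3 : X * R = V₂ * (star V₂ * (X * R)) := by
      conv_lhs => rw [← one_mul (X * R), ← hV, add_mul, mul_assoc, mul_assoc, r1', mul_zero,
        zero_add]
    have r4 : R = Z * (V₂ * (star V₂ * (X * R))) := by
      rw [← r3, ← mul_assoc, hZX, one_mul]
    have r5 : b * (star V₂ * (X * R)) = 0 := by
      rw [r4] at r2'
      rw [hbdef]
      simpa only [mul_assoc] using r2'
    have r6 : star V₂ * (X * R) = 0 := hb.isUnit.mul_right_eq_zero.1 r5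
    rw [r6, mul_zero, mul_zero] at r4
    exact (sub_eq_zero.1 (hRdef ▸ r4)).symm
  refine ⟨V₁ * W₁ + V₂ * W₂, ?_, ?_⟩
  · rw [Unitary.mem_iff]
    constructor
    · rw [star_add, star_mul, star_mul]
      simp only [add_mul, mul_add, mul_assoc, tr h1, tr h2, tr h12, tr h21, one_mul, zero_mul,
        mul_zero, add_zero, zero_add, hR]
    · rw [star_add, star_mul, star_mul]
      simp only [add_mul, mul_add, mul_assoc, tr e11, tr e22, tr e12, tr e21, one_mul, zero_mul,
        mul_zero, add_zero, zero_add, hV]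
  · have l : star V₁ * (V₁ * W₁ + V₂ * W₂) = W₁ := by
      rw [mul_add, ← mul_assoc, ← mul_assoc, h1, h12]; simp
    have l' := congrArg star l
    rw [star_mul, star_star] at l'
    calc _ = (star (V₁ * W₁ + V₂ * W₂) * V₁) * a * (star V₁ * (V₁ * W₁ + V₂ * W₂)) := by
          simp only [mul_assoc]
      _ = X * V₁ * (α * a * α) * star V₁ * X := by
          rw [l, l', sW₁, hW₁]; simp only [mul_assoc]
      _ = _ := by rw [haa]; simp only [mul_one, mul_assoc]

end Polar

/-! ### The two inequalities with the perspective -/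

namespace IsRegularSublinear

variable {H : Type*} [NormedAddCommGroup H] [InnerProductSpace ℂ H] [CompleteSpace H]
  {F : (H →L[ℂ] H) → (H →L[ℂ] H) → (H →L[ℂ] H)} (hF : IsRegularSublinear F)
  {A B : H →L[ℂ] H} {f : ℝ → ℝ} (hf : ∀ t : ℝ, 0 ≤ t → F 1 (t • 1) = f t • 1)

include hF

theorem map_sum_le {ι : Type*} (s : Finset ι) {M N : ι → H →L[ℂ] H} (hM : ∀ i, 0 ≤ M i)
    (hN : ∀ i, 0 ≤ N i) : F (∑ i ∈ s, M i) (∑ i ∈ s, N i) ≤ ∑ i ∈ s, F (M i) (N i) := by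
  classical
  induction s using Finset.induction_on with
  | empty => simp [hF.map_zero]
  | insert i s hi ih =>
    rw [Finset.sum_insert hi, Finset.sum_insert hi, Finset.sum_insert hi]
    exact (hF.add_le (hM i) (Finset.sum_nonneg fun j _ => hM j) (hN i)
      (Finset.sum_nonneg fun j _ => hN j)).trans (add_le_add_right ih _)

include hf

/-- Jensen applied to `(p, t • p)` with `p = V₁ * star V₁`; the partial isometry `V₂ * star V₁`
embeds this corner in its complement. -/
theorem map_range_projection_le {V₁ V₂ a : H →L[ℂ] H} (h1 : star V₁ * V₁ = 1)
    (h2 : star V₂ * V₂ = 1) (h12 : star V₁ * V₂ = 0) (ha : IsStrictlyPositive a) {t : ℝ}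
    (ht : 0 ≤ t) :
    F (V₁ * a * star V₁) (t • (V₁ * a * star V₁)) ≤ f t • (V₁ * a * star V₁) := by
  have hp : IsStarProjection (V₁ * star V₁) := by
    refine ⟨?_, by simp [isSelfAdjoint_iff]⟩
    rw [IsIdempotentElem, mul_assoc, ← mul_assoc (star V₁), h1, one_mul]
  set c := a ^ (1 / 2 : ℝ) with hc
  have hcs : star c = c := isSelfAdjoint_rpow a _
  have hcc : c * c = a := ha.rpow_half_mul_self
  have tr : ∀ {a b c : H →L[ℂ] H}, a * b = c → ∀ x, a * (b * x) = c * x := fun h x => by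
    rw [← mul_assoc, h]
  have hK : IsSelfAdjoint (V₁ * c * star V₁) := by
    simp [isSelfAdjoint_iff, hcs, mul_assoc]
  have h := hF.map_conj_le (v := V₂ * star V₁) (K := V₁ * c * star V₁) (A := V₁ * star V₁)
    (B := t • (V₁ * star V₁)) hp (by simp [mul_assoc, tr h2]) (by simp [mul_assoc, tr h12]) hK
    (by simp [mul_assoc, tr h1]) hp.nonneg (smul_nonneg ht hp.nonneg) hp.isIdempotentElem
    (by rw [mul_smul_comm, hp.isIdempotentElem.eq])
  have e : V₁ * c * star V₁ * (V₁ * star V₁) * (V₁ * c * star V₁) = V₁ * a * star V₁ := by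
    simp only [mul_assoc, tr h1, one_mul, ← hcc]
  rwa [hF.map_projection hf hp ht, mul_smul_comm, smul_mul_assoc, mul_smul_comm, smul_mul_assoc,
    e] at h

/-- `M` is the sum of the two pieces M^(1/2) V_i V_i* M^(1/2). Each is unitarily equivalent to an
operator in the corner V_i V_i*, which has room, and subadditivity reassembles them. -/
theorem map_smul_le (hdim : ¬ FiniteDimensional ℂ H) {M : H →L[ℂ] H} (hM : IsStrictlyPositive M)
    {t : ℝ} (ht : 0 ≤ t) : F M (t • M) ≤ f t • M := by
  obtain ⟨V₁, V₂, h1, h2, h12, h21, hV⟩ := exists_cuntz_isometries hdim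
  have key : ∀ {V₁ V₂ : H →L[ℂ] H}, star V₁ * V₁ = 1 → star V₂ * V₂ = 1 → star V₁ * V₂ = 0 →
      star V₂ * V₁ = 0 → V₁ * star V₁ + V₂ * star V₂ = 1 →
      0 ≤ M ^ (1 / 2 : ℝ) * (V₁ * star V₁) * M ^ (1 / 2 : ℝ) ∧
      F (M ^ (1 / 2 : ℝ) * (V₁ * star V₁) * M ^ (1 / 2 : ℝ))
        (t • (M ^ (1 / 2 : ℝ) * (V₁ * star V₁) * M ^ (1 / 2 : ℝ))) ≤
      f t • (M ^ (1 / 2 : ℝ) * (V₁ * star V₁) * M ^ (1 / 2 : ℝ)) := by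
    intro V₁ V₂ h1 h2 h12 h21 hV
    refine ⟨(isSelfAdjoint_rpow M _).conj_nonneg (mul_star_self_nonneg V₁), ?_⟩
    obtain ⟨w, hw, hwM⟩ := exists_unitary_conj_range_projection h1 h2 h12 h21 hV hM
    have ha := hM.isometry_conj h1
    have hn : 0 ≤ V₁ * (star V₁ * M * V₁) * star V₁ :=
      star_right_conjugate_nonneg ha.nonneg V₁
    have h := star_left_conjugate_le_conjugate (hF.map_range_projection_le hf h1 h2 h12 ha ht) w
    rwa [← hF.unitary_map hw hn (smul_nonneg ht hn), mul_smul_comm, smul_mul_assoc,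
      mul_smul_comm, smul_mul_assoc, hwM] at h
  obtain ⟨n1, k1⟩ := key h1 h2 h12 h21 hV
  obtain ⟨n2, k2⟩ := key h2 h1 h21 h12 (by rw [add_comm]; exact hV)
  have h := hF.add_le n1 n2 (smul_nonneg ht n1) (smul_nonneg ht n2)
  have e : M ^ (1 / 2 : ℝ) * (V₁ * star V₁) * M ^ (1 / 2 : ℝ) +
      M ^ (1 / 2 : ℝ) * (V₂ * star V₂) * M ^ (1 / 2 : ℝ) = M := by
    rw [← add_mul, ← mul_add, hV, mul_one, hM.rpow_half_mul_self]
  rw [← smul_add, e] at h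
  have h' := h.trans (add_le_add k1 k2)
  rwa [← smul_add, e] at h'

theorem map_le_perspective (hdim : ¬ FiniteDimensional ℂ H) (hfc : Continuous f)
    (hA : IsStrictlyPositive A) (hB : IsStrictlyPositive B) :
    F A B ≤ A ^ (1 / 2 : ℝ) * cfc f (A ^ (-(1 / 2) : ℝ) * B * A ^ (-(1 / 2) : ℝ)) *
      A ^ (1 / 2 : ℝ) := by
  set C := A ^ (1 / 2 : ℝ) with hC
  set L := A ^ (-(1 / 2) : ℝ) with hL
  have hCs : IsSelfAdjoint C := isSelfAdjoint_rpow A _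
  have hLs : IsSelfAdjoint L := isSelfAdjoint_rpow A _
  have hCL : C * L = 1 := hA.rpow_half_mul_rpow_neg_half
  have hLC : L * C = 1 := hA.rpow_neg_half_mul_rpow_half
  set D := L * B * L with hD
  have hDp : IsStrictlyPositive D := hB.conj hA.rpow_neg_half_isUnit hLs
  have hDs : IsSelfAdjoint D := .of_nonneg hDp.nonneg
  have hCDC : C * D * C = B := by
    calc C * D * C = (C * L) * B * (L * C) := by rw [hD]; simp only [mul_assoc]
      _ = B := by rw [hCL, hLC, one_mul, mul_one]
  obtain ⟨a, b, ha, -, hb, hs⟩ := hDp.exists_spectrum_subset_Icc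
  have main : ∀ ε : ℝ, 0 < ε → F A B ≤ C * cfc f D * C + ε • A := by
    intro ε hε
    obtain ⟨n, d, w, hd, hw, hall⟩ :=
      exists_bernstein_weights hfc ha (zero_lt_one.trans_le hb) hε
    have hMpos : ∀ k, IsStrictlyPositive (C * cfc (w k) D * C) := by
      intro k
      refine IsStrictlyPositive.conj hA.rpow_half_isUnit hCs ?_
      rw [StarOrderedRing.isStrictlyPositive_iff_spectrum_pos (R := ℝ) _ (cfc_predicate _ _),
        cfc_map_spectrum (w k) D hDs (hw k).continuousOn]
      rintro _ ⟨x, hx, rfl⟩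
      exact (hall x (hs hx)).1 k
    -- Used with coefficients `1`, `d k` and `f (d k)`, giving `A`, `B` and an approximation to the
    -- perspective.
    have hsum : ∀ c : Fin n → ℝ, ∑ k, c k • (C * cfc (w k) D * C) =
        C * cfc (fun t => ∑ k, c k * w k t) D * C := by
      intro c
      have e : (fun t => ∑ k, c k * w k t) = ∑ k, fun t => c k * w k t := by
        ext t
        rw [Finset.sum_apply]
      rw [e, cfc_sum_univ (fun k t => c k * w k t) D (fun k => by fun_prop), Finset.mul_sum,
        Finset.sum_mul]
      refine Finset.sum_congr rfl fun k _ => ?_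
      rw [cfc_const_mul (c k) (w k) D (hw k).continuousOn, mul_smul_comm, smul_mul_assoc]
    have s1 : ∑ k, C * cfc (w k) D * C = A := by
      have := hsum fun _ => 1
      simp only [one_smul, one_mul] at this
      rw [this, cfc_congr (g := fun _ => (1 : ℝ)) fun t ht => (hall t (hs ht)).2.1,
        cfc_const_one ℝ D, mul_one]
      exact hA.rpow_half_mul_self
    have s2 : ∑ k, d k • (C * cfc (w k) D * C) = B := by
      rw [hsum, cfc_congr (g := fun t => t) fun t ht => (hall t (hs ht)).2.2.1, cfc_id' ℝ D]
      exact hCDC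
    have h1 := hF.map_sum_le Finset.univ (fun k => (hMpos k).nonneg)
      (fun k => smul_nonneg (hd k) (hMpos k).nonneg)
    rw [s1, s2] at h1
    have h2 := h1.trans (Finset.sum_le_sum fun k _ =>
      hF.map_smul_le hf hdim (hMpos k) (hd k))
    rw [hsum fun k => f (d k)] at h2
    refine h2.trans ?_
    have h3 : cfc (fun t => ∑ k, f (d k) * w k t) D ≤ cfc f D + ε • 1 := by
      rw [← Algebra.algebraMap_eq_smul_one, ← cfc_const ε D, ← cfc_add D f (fun _ => ε)]
      refine cfc_mono (fun t ht => ?_) (by fun_prop) (by fun_prop)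
      have := (abs_le.1 (hall t (hs ht)).2.2.2).2
      linarith
    have h4 := hCs.conj_le_conj h3
    rwa [mul_add, add_mul, mul_smul_comm, smul_mul_assoc, mul_one, hA.rpow_half_mul_self] at h4
  rw [ContinuousLinearMap.le_iff_re_inner (hF.isSelfAdjoint hA.nonneg hB.nonneg)
    (by have := (cfc_predicate f D : IsSelfAdjoint _).conjugate C; rwa [hCs.star_eq] at this)]
  intro ξ
  have h : ∀ ε : ℝ, 0 < ε → (inner ℂ (F A B ξ) ξ).re ≤
      (inner ℂ ((C * cfc f D * C) ξ) ξ).re + ε * (inner ℂ (A ξ) ξ).re := by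
    intro ε hε
    have := ContinuousLinearMap.re_inner_mono (main ε hε) ξ
    rwa [_root_.add_apply, inner_add_left, Complex.add_re, _root_.smul_apply,
      re_inner_real_smul_left] at this
  have hlim : Tendsto (fun ε : ℝ => (inner ℂ ((C * cfc f D * C) ξ) ξ).re +
      ε * (inner ℂ (A ξ) ξ).re) (𝓝[>] 0) (𝓝 ((inner ℂ ((C * cfc f D * C) ξ) ξ).re)) := by
    refine Tendsto.mono_left ?_ nhdsWithin_le_nhds
    have : Continuous fun ε : ℝ => (inner ℂ ((C * cfc f D * C) ξ) ξ).re +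
      ε * (inner ℂ (A ξ) ξ).re := by fun_prop
    simpa using this.tendsto 0
  exact ge_of_tendsto hlim (by filter_upwards [self_mem_nhdsWithin] with ε hε using h ε hε)

end IsRegularSublinear

/-- The bound holds for compressions to spans of finite sets and passes to the limit in quadratic
forms. Adding `1 - P s` keeps the compressions invertible within fixed spectral bounds, so roots and
functional calculi converge strongly. -/
theorem IsRegularSublinear.perspective_le {H : Type*} [NormedAddCommGroup H]
    [InnerProductSpace ℂ H] [CompleteSpace H] {F : (H →L[ℂ] H) → (H →L[ℂ] H) → (H →L[ℂ] H)}
    (hF : IsRegularSublinear F) {A B : H →L[ℂ] H} {f : ℝ → ℝ}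
    (hf : ∀ t : ℝ, 0 ≤ t → F 1 (t • 1) = f t • 1) (hdim : ¬ FiniteDimensional ℂ H)
    (hfc : Continuous f) (hA : IsStrictlyPositive A) (hB : IsStrictlyPositive B) :
    A ^ (1 / 2 : ℝ) * cfc f (A ^ (-(1 / 2) : ℝ) * B * A ^ (-(1 / 2) : ℝ)) * A ^ (1 / 2 : ℝ) ≤
      F A B := by
  obtain ⟨a, b, ha0, ha1, hb1, haA, hAb, hsA⟩ := hA.exists_smul_one_le
  obtain ⟨a', b', ha0', ha1', hb1', haB, hBb, hsB⟩ := hB.exists_smul_one_le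
  let P : Finset H → H →L[ℂ] H := fun s => (Submodule.span ℂ (s : Set H)).starProjection
  have hP : ∀ s, IsStarProjection (P s) := fun s => isStarProjection_starProjection
  let X : Finset H → H →L[ℂ] H := fun s => P s * A * P s + (1 - P s)
  let Y : Finset H → H →L[ℂ] H := fun s => P s * B * P s + (1 - P s)
  have hX1 := fun s => (hP s).compress_add_bounds haA hAb ha1 hb1
  have hY1 := fun s => (hP s).compress_add_bounds haB hBb ha1' hb1'
  have hX : ∀ s, IsStrictlyPositive (X s) := fun s => isStrictlyPositive_of_smul_one_le ha0 (hX1 s).1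
  have hY : ∀ s, IsStrictlyPositive (Y s) := fun s => isStrictlyPositive_of_smul_one_le ha0' (hY1 s).1
  have hXsa : ∀ s, IsSelfAdjoint (X s) := fun s => .of_nonneg (hX s).nonneg
  have hXs : ∀ s, spectrum ℝ (X s) ⊆ Set.Icc a b := fun s =>
    spectrum_subset_Icc (hXsa s) (hX1 s).1 (hX1 s).2
  have hXlim : ∀ η, Tendsto (fun s => X s η) atTop (𝓝 (A η)) := tendsto_compress_add A
  have hYlim : ∀ η, Tendsto (fun s => Y s η) atTop (𝓝 (B η)) := tendsto_compress_add B
  have hrpow : ∀ y : ℝ, ContinuousOn (fun x : ℝ => x ^ y) (Set.Icc a b) := fun y x hx =>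
    (Real.continuousAt_rpow_const _ _ (.inl (ha0.trans_le hx.1).ne')).continuousWithinAt
  have hpow : ∀ y : ℝ, (∃ M, ∀ s, ‖X s ^ y‖ ≤ M) ∧
      ∀ η, Tendsto (fun s => (X s ^ y) η) atTop (𝓝 ((A ^ y) η)) := by
    intro y
    have e : ∀ s, X s ^ y = cfc (fun x : ℝ => x ^ y) (X s) := fun s =>
      CFC.rpow_eq_cfc_real (hX s).nonneg
    have e' : A ^ y = cfc (fun x : ℝ => x ^ y) A := CFC.rpow_eq_cfc_real hA.nonneg
    constructor
    · obtain ⟨M, hM⟩ := exists_norm_cfc_le H (hrpow y)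
      exact ⟨M, fun s => by rw [e]; exact hM _ (hXs s)⟩
    · simp only [e, e']
      exact tendsto_cfc_apply_of_intertwine (V := 1) (hrpow y) hXsa (.of_nonneg hA.nonneg) hXs hsA
        hXlim
  obtain ⟨⟨MK, hMK⟩, hKlim⟩ := hpow (1 / 2)
  obtain ⟨⟨ML, hML⟩, hLlim⟩ := hpow (-(1 / 2))
  have hMY : ∀ s, ‖Y s‖ ≤ b' := fun s =>
    norm_le_of_smul_one_le ha0'.le (hY1 s).1 (hY1 s).2 (by linarith)
  have hLsa : ∀ s, IsSelfAdjoint (X s ^ (-(1 / 2) : ℝ)) := fun s => isSelfAdjoint_rpow _ _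
  have hconj : ∀ {L T : H →L[ℂ] H}, IsSelfAdjoint L → IsSelfAdjoint T →
      IsSelfAdjoint (L * T * L) := fun {L T} hL hT => by
    have := hT.conjugate L
    rwa [hL.star_eq] at this
  let D : Finset H → H →L[ℂ] H := fun s => X s ^ (-(1 / 2) : ℝ) * Y s * X s ^ (-(1 / 2) : ℝ)
  have hDsa : ∀ s, IsSelfAdjoint (D s) := fun s =>
    hconj (hLsa s) (.of_nonneg (hY s).nonneg)
  have hDnorm : ∀ s, ‖D s‖ ≤ ML * b' * ML := by
    intro s
    refine (norm_mul_le _ _).trans ?_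
    have := (norm_mul_le (X s ^ (-(1 / 2) : ℝ)) (Y s)).trans
      (mul_le_mul (hML s) (hMY s) (norm_nonneg _) ((norm_nonneg _).trans (hML s)))
    exact mul_le_mul this (hML s) (norm_nonneg _) ((norm_nonneg _).trans this)
  set D₀ := A ^ (-(1 / 2) : ℝ) * B * A ^ (-(1 / 2) : ℝ) with hD₀
  have hD₀sa : IsSelfAdjoint D₀ := hconj (isSelfAdjoint_rpow _ _) (.of_nonneg hB.nonneg)
  have hDlim : ∀ η, Tendsto (fun s => D s η) atTop (𝓝 (D₀ η)) := fun η =>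
    tendsto_apply_of_norm_le hML hLlim (tendsto_apply_of_norm_le hMY hYlim (hLlim η))
  set M := max (ML * b' * ML) ‖D₀‖ with hM
  have hDs : ∀ s, spectrum ℝ (D s) ⊆ Set.Icc (-M) M := fun s =>
    spectrum_subset_Icc_of_norm_le (hDsa s) ((hDnorm s).trans (le_max_left _ _))
  have hflim : ∀ η, Tendsto (fun s => cfc f (D s) η) atTop (𝓝 (cfc f D₀ η)) :=
    tendsto_cfc_apply_of_intertwine (V := 1) hfc.continuousOn hDsa hD₀sa hDs
      (spectrum_subset_Icc_of_norm_le hD₀sa (le_max_right _ _)) hDlim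
  obtain ⟨Mf, hMf⟩ := exists_norm_cfc_le H (hfc.continuousOn (s := Set.Icc (-M) M))
  have hPlim : ∀ η, Tendsto (fun s => P s η) atTop (𝓝 ((1 : H →L[ℂ] H) η)) := fun η =>
    tendsto_const_nhds.congr'
      ((eventually_starProjection_span_eq η).mono fun s h => h.symm)
  have hPnorm : ∀ s, ‖P s‖ ≤ 1 := fun s => Submodule.starProjection_norm_le _
  have hineq : ∀ s, X s ^ (1 / 2 : ℝ) * (cfc f (D s) * P s) * X s ^ (1 / 2 : ℝ) ≤
      P s * F A B * P s := by
    intro s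
    have hPP : P s * P s = P s := (hP s).isIdempotentElem
    have c1 : ∀ T, P s * (P s * T * P s + (1 - P s)) = P s * T * P s := fun T => by
      rw [mul_add, mul_sub, hPP, ← mul_assoc, ← mul_assoc, hPP]; simp
    have c2 : ∀ T, (P s * T * P s + (1 - P s)) * P s = P s * T * P s := fun T => by
      rw [add_mul, sub_mul, hPP, mul_assoc (P s * T), hPP]; simp
    have hc : Commute (X s ^ (1 / 2 : ℝ)) (P s) := by
      rw [CFC.rpow_eq_cfc_real (hX s).nonneg]
      exact Commute.cfc_real ((c2 A).trans (c1 A).symm) _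
    exact hF.conj_cfc_mul_le_compress hf hdim hfc _ hA.nonneg hB.nonneg (hY s).nonneg
      (isSelfAdjoint_rpow _ _) (hLsa s) (hX s).rpow_half_mul_rpow_neg_half
      (hX s).rpow_neg_half_mul_rpow_half hc (hX s).rpow_half_mul_self (c1 A)
      ((c2 B).trans (c1 B).symm) (c1 B) rfl
  rw [ContinuousLinearMap.le_iff_re_inner (hconj (isSelfAdjoint_rpow _ _) (cfc_predicate f D₀))
    (hF.isSelfAdjoint hA.nonneg hB.nonneg)]
  intro ξ
  have l1 : Tendsto (fun s => (inner ℂ ((X s ^ (1 / 2 : ℝ) * (cfc f (D s) * P s) *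
      X s ^ (1 / 2 : ℝ)) ξ) ξ).re) atTop
      (𝓝 (inner ℂ ((A ^ (1 / 2 : ℝ) * cfc f D₀ * A ^ (1 / 2 : ℝ)) ξ) ξ).re) := by
    have := tendsto_apply_of_norm_le hMK hKlim (tendsto_apply_of_norm_le (fun s => hMf _ (hDs s))
      hflim (tendsto_apply_of_norm_le hPnorm hPlim (hKlim ξ)))
    exact (Complex.continuous_re.tendsto _).comp (this.inner tendsto_const_nhds)
  have l2 : Tendsto (fun s => (inner ℂ ((P s * F A B * P s) ξ) ξ).re) atTop
      (𝓝 (inner ℂ (F A B ξ) ξ).re) := by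
    have := tendsto_apply_of_norm_le hPnorm hPlim
      (((F A B).continuous.tendsto _).comp (hPlim ξ))
    exact (Complex.continuous_re.tendsto _).comp (this.inner tendsto_const_nhds)
  exact le_of_tendsto_of_tendsto' l1 l2 fun s =>
    ContinuousLinearMap.re_inner_mono (hineq s) ξ

/-! ### Operator convexity on every Hilbert space -/

section OperatorConvexity

variable {K H : Type*} [NormedAddCommGroup K] [InnerProductSpace ℂ K] [CompleteSpace K]
  [NormedAddCommGroup H] [InnerProductSpace ℂ H] [CompleteSpace H]

/-- A compression of operators to a finite-dimensional subspace can be realised on any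
infinite-dimensional Hilbert space. -/
theorem exists_compression_transfer (hdim : ¬ FiniteDimensional ℂ H) {f : ℝ → ℝ}
    (hf : Continuous f) (E : Submodule ℂ K) [FiniteDimensional ℂ E] {ξ : K} (hξ : ξ ∈ E) :
    ∃ (Φ : (K →L[ℂ] K) → (H →L[ℂ] H)) (η : H),
      (∀ A B, Φ ((1 / 2 : ℝ) • (A + B)) = (1 / 2 : ℝ) • (Φ A + Φ B)) ∧
      (∀ T, IsStrictlyPositive T → IsStrictlyPositive (Φ T)) ∧
      ∀ T, IsStrictlyPositive T → inner ℂ (cfc f (E.starProjection * T * E.starProjection +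
        (1 - E.starProjection)) ξ) ξ = inner ℂ (cfc f (Φ T) η) η := by
  obtain ⟨U, hU⟩ := exists_partialIsometry hdim E
  set P := E.starProjection with hPdef
  have hP : IsStarProjection P := isStarProjection_starProjection
  have hUU : ∀ x, ContinuousLinearMap.adjoint U (U x) = P x := fun x => by rw [← hU]; rfl
  have hPξ : P ξ = ξ := Submodule.starProjection_eq_self_iff.2 hξ
  have hPP : ∀ x, P (P x) = P x := fun x => DFunLike.congr_fun hP.isIdempotentElem x
  have hUP : ∀ x, U (P x) = U x := by
    intro x
    rw [← sub_eq_zero, ← map_sub, ← norm_eq_zero, ← sq_eq_zero_iff,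
      ContinuousLinearMap.apply_norm_sq_eq_inner_adjoint_left]
    simp [hUU, hPP]
  set Q : H →L[ℂ] H := U ∘L ContinuousLinearMap.adjoint U with hQ
  have hQP : IsStarProjection Q := by
    refine ⟨?_, ?_⟩
    · ext x
      simp [hQ, ContinuousLinearMap.mul_def, hUU, hUP]
    · rw [isSelfAdjoint_iff, ContinuousLinearMap.star_eq_adjoint, hQ,
        ContinuousLinearMap.adjoint_comp, ContinuousLinearMap.adjoint_adjoint]
  -- `U` intertwines the compression `P * T * P + (1 - P)` with `Φ T`; the summand `1 - Q` preserves
  -- strict positivity.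
  let Φ : (K →L[ℂ] K) → (H →L[ℂ] H) := fun T => U ∘L T ∘L ContinuousLinearMap.adjoint U + (1 - Q)
  have hΦ : ∀ T, IsStrictlyPositive T → IsStrictlyPositive (Φ T) := by
    intro T hT
    obtain ⟨a, b, ha0, ha1, -, haT, -, -⟩ := hT.exists_smul_one_le
    refine isStrictlyPositive_of_smul_one_le ha0 ?_
    have h1 : 0 ≤ U ∘L (T - a • 1) ∘L ContinuousLinearMap.adjoint U :=
      (ContinuousLinearMap.nonneg_iff_isPositive _).2
        (((ContinuousLinearMap.le_def _ _).1 haT).conj_adjoint U)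
    have h2 : 0 ≤ (1 - a) • (1 - Q) := smul_nonneg (sub_nonneg.2 ha1) hQP.one_sub.nonneg
    have h3 := add_nonneg h1 h2
    have e : U ∘L (T - a • 1) ∘L ContinuousLinearMap.adjoint U + (1 - a) • (1 - Q) =
        Φ T - a • 1 := by
      ext x
      simp [Φ, hQ, sub_smul, smul_sub]
      abel
    rw [e] at h3
    exact sub_nonneg.1 h3
  refine ⟨Φ, U ξ, ?_, hΦ, ?_⟩
  · intro A B
    ext x
    simp only [Φ, _root_.add_apply, _root_.smul_apply, ContinuousLinearMap.comp_apply,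
      map_add, smul_add]
    rw [← Complex.coe_smul, ← Complex.coe_smul, map_smul, map_smul]
    have : (1 - Q) x = (1 / 2 : ℝ) • (1 - Q) x + (1 / 2 : ℝ) • (1 - Q) x := by
      rw [← add_smul]; norm_num
    nth_rewrite 1 [this]
    simp only [Complex.coe_smul]
    abel
  · intro T hT
    obtain ⟨a, b, ha0, ha1, hb1, haT, hTb, -⟩ := hT.exists_smul_one_le
    have hTP : IsStrictlyPositive (P * T * P + (1 - P)) :=
      isStrictlyPositive_of_smul_one_le ha0 (hP.compress_add_bounds haT hTb ha1 hb1).1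
    have h := cfc_comp_eq_of_intertwine hf (T := Φ T) (S := P * T * P + (1 - P)) (V := U)
      (.of_nonneg (hΦ T hT).nonneg) (.of_nonneg hTP.nonneg)
      (fun x => by simp [Φ, hQ, ContinuousLinearMap.mul_def, hUU, hUP]) ξ
    rw [h, ← ContinuousLinearMap.adjoint_inner_right U, hUU, hPξ]

theorem re_inner_cfc_midpoint_le (hdim : ¬ FiniteDimensional ℂ H) {f : ℝ → ℝ} (hf : Continuous f)
    (hmid : ∀ X Y : H →L[ℂ] H, IsStrictlyPositive X → IsStrictlyPositive Y →
      cfc f ((1 / 2 : ℝ) • (X + Y)) ≤ (1 / 2 : ℝ) • (cfc f X + cfc f Y))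
    {A B : K →L[ℂ] K} (hA : IsStrictlyPositive A) (hB : IsStrictlyPositive B) (ξ : K) :
    (inner ℂ (cfc f ((1 / 2 : ℝ) • (A + B)) ξ) ξ).re ≤
      ((inner ℂ (cfc f A ξ) ξ).re + (inner ℂ (cfc f B ξ) ξ).re) / 2 := by
  have hC : IsStrictlyPositive ((1 / 2 : ℝ) • (A + B)) := by
    obtain ⟨a, -, ha0, -, -, haA, -, -⟩ := hA.exists_smul_one_le
    obtain ⟨b, -, hb0, -, -, hbB, -, -⟩ := hB.exists_smul_one_le
    have := smul_le_smul_of_nonneg_left (add_le_add haA hbB) (show (0 : ℝ) ≤ 1 / 2 by norm_num)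
    rw [← add_smul, smul_smul] at this
    exact isStrictlyPositive_of_smul_one_le (by positivity) this
  have hlim : ∀ {T : K →L[ℂ] K}, IsStrictlyPositive T → Tendsto (fun s : Finset K =>
      (inner ℂ (cfc f ((Submodule.span ℂ (s : Set K)).starProjection * T *
        (Submodule.span ℂ (s : Set K)).starProjection +
        (1 - (Submodule.span ℂ (s : Set K)).starProjection)) ξ) ξ).re) atTop
      (𝓝 (inner ℂ (cfc f T ξ) ξ).re) := by
    intro T hT
    obtain ⟨a, b, ha0, ha1, hb1, haT, hTb, hs⟩ := hT.exists_smul_one_le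
    have hbd := fun s : Finset K => (isStarProjection_starProjection
      (U := Submodule.span ℂ (s : Set K))).compress_add_bounds haT hTb ha1 hb1
    have hsa := fun s : Finset K => IsSelfAdjoint.of_nonneg
      (isStrictlyPositive_of_smul_one_le ha0 (hbd s).1).nonneg
    have := tendsto_cfc_apply_of_intertwine (V := 1) (hf.continuousOn (s := Set.Icc a b))
      hsa (.of_nonneg hT.nonneg)
      (fun s => spectrum_subset_Icc (hsa s) (hbd s).1 (hbd s).2) hs (tendsto_compress_add T) ξ
    exact (Complex.continuous_re.tendsto _).comp (this.inner tendsto_const_nhds)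
  refine le_of_tendsto_of_tendsto (hlim hC) (((hlim hA).add (hlim hB)).div_const 2) ?_
  filter_upwards [eventually_ge_atTop {ξ}] with s hs
  obtain ⟨Φ, η, hΦadd, hΦ, hΦf⟩ := exists_compression_transfer hdim hf
    (Submodule.span ℂ (s : Set K)) (Submodule.subset_span (show ξ ∈ (s : Set K) by simpa using hs))
  rw [hΦf _ hC, hΦf _ hA, hΦf _ hB, hΦadd]
  have := ContinuousLinearMap.re_inner_mono (hmid _ _ (hΦ A hA) (hΦ B hB)) η
  rw [_root_.smul_apply, re_inner_real_smul_left, _root_.add_apply, inner_add_left,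
    Complex.add_re] at this
  linarith

/-- For a fixed vector, the quadratic form of f along the segment from B to A is a continuous
midpoint convex scalar function on [0, 1], hence lies below its chord. -/
theorem operatorConvexOn_of_midpoint (hdim : ¬ FiniteDimensional ℂ H) {f : ℝ → ℝ}
    (hf : Continuous f)
    (hmid : ∀ X Y : H →L[ℂ] H, IsStrictlyPositive X → IsStrictlyPositive Y →
      cfc f ((1 / 2 : ℝ) • (X + Y)) ≤ (1 / 2 : ℝ) • (cfc f X + cfc f Y)) :
    OperatorConvexOn.{v} (Set.Ioi 0) f := by
  refine ⟨hf.continuousOn, fun K _ _ _ A B hA hB hsA hsB s hs0 hs1 => ?_⟩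
  have hcomb : ∀ S T : K →L[ℂ] K, IsSelfAdjoint S → IsSelfAdjoint T →
      IsSelfAdjoint (s • S + (1 - s) • T) := fun S T hS hT =>
    (hS.real_smul s).add (hT.real_smul (1 - s))
  rw [ContinuousLinearMap.le_iff_re_inner (cfc_predicate f _)
    (hcomb _ _ (cfc_predicate f A) (cfc_predicate f B))]
  intro ξ
  obtain ⟨a, b, ha0, -, -, haA⟩ := exists_spectrum_subset_Icc hsA
  obtain ⟨a', b', ha0', -, -, haB⟩ := exists_spectrum_subset_Icc hsB
  obtain ⟨lA, uA⟩ := smul_one_le_of_spectrum_subset hA haA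
  obtain ⟨lB, uB⟩ := smul_one_le_of_spectrum_subset hB haB
  have mono : ∀ {c d : ℝ}, c ≤ d → c • (1 : K →L[ℂ] K) ≤ d • 1 := fun h =>
    smul_le_smul_of_nonneg_right h zero_le_one
  have lA' := (mono (min_le_left a a')).trans lA
  have lB' := (mono (min_le_right a a')).trans lB
  have uA' := uA.trans (mono (le_max_left b b'))
  have uB' := uB.trans (mono (le_max_right b b'))
  have e : ∀ (x c : ℝ), x • (c • (1 : K →L[ℂ] K)) + (1 - x) • (c • 1) = c • 1 := fun x c => by
    rw [← add_smul, add_sub_cancel, one_smul]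
  have hl : ∀ x ∈ Set.Icc (0 : ℝ) 1, min a a' • 1 ≤ x • A + (1 - x) • B := fun x hx => by
    rw [← e x (min a a')]
    exact add_le_add (smul_le_smul_of_nonneg_left lA' hx.1)
      (smul_le_smul_of_nonneg_left lB' (sub_nonneg.2 hx.2))
  have hu : ∀ x ∈ Set.Icc (0 : ℝ) 1, x • A + (1 - x) • B ≤ max b b' • 1 := fun x hx => by
    rw [← e x (max b b')]
    exact add_le_add (smul_le_smul_of_nonneg_left uA' hx.1)
      (smul_le_smul_of_nonneg_left uB' (sub_nonneg.2 hx.2))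
  have hpos : ∀ x ∈ Set.Icc (0 : ℝ) 1, IsStrictlyPositive (x • A + (1 - x) • B) := fun x hx =>
    isStrictlyPositive_of_smul_one_le (lt_min ha0 ha0') (hl x hx)
  set φ : ℝ → ℝ := fun x => (inner ℂ (cfc f (x • A + (1 - x) • B) ξ) ξ).re with hφ
  have hcont : ContinuousOn φ (Set.Icc 0 1) := by
    rw [continuousOn_iff_continuous_domRestrict, continuous_iff_continuousAt]
    intro x
    have := tendsto_cfc_apply_of_intertwine (ι := Set.Icc (0 : ℝ) 1) (l := 𝓝 x)
      (hf.continuousOn (s := Set.Icc (min a a') (max b b')))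
      (T := fun y => (y : ℝ) • A + (1 - (y : ℝ)) • B) (S := (x : ℝ) • A + (1 - (x : ℝ)) • B)
      (V := 1) (fun y => .of_nonneg (hpos y y.2).nonneg) (.of_nonneg (hpos x x.2).nonneg)
      (fun y => spectrum_subset_Icc (.of_nonneg (hpos y y.2).nonneg) (hl y y.2) (hu y y.2))
      (spectrum_subset_Icc (.of_nonneg (hpos x x.2).nonneg) (hl x x.2) (hu x x.2))
      (fun η => by
        have : Continuous fun y : Set.Icc (0 : ℝ) 1 => (y : ℝ) • A η + (1 - (y : ℝ)) • B η := by
          fun_prop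
        exact this.tendsto x) ξ
    exact (Complex.continuous_re.tendsto _).comp (this.inner tendsto_const_nhds)
  have hφmid : ∀ x ∈ Set.Icc (0 : ℝ) 1, ∀ y ∈ Set.Icc (0 : ℝ) 1,
      φ ((x + y) / 2) ≤ (φ x + φ y) / 2 := by
    intro x hx y hy
    have := re_inner_cfc_midpoint_le hdim hf hmid (hpos x hx) (hpos y hy) ξ
    have e1 : (1 / 2 : ℝ) • (x • A + (1 - x) • B + (y • A + (1 - y) • B)) =
        ((x + y) / 2) • A + (1 - (x + y) / 2) • B := by
      module
    rwa [e1] at this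
  have h := continuousOn_midpoint_convex hcont hφmid (s := s) ⟨hs0, hs1⟩
  simp only [hφ, one_smul, sub_self, zero_smul, add_zero, zero_add, sub_zero] at h
  refine h.trans (le_of_eq ?_)
  rw [_root_.add_apply, inner_add_left, _root_.smul_apply, _root_.smul_apply, Complex.add_re,
    re_inner_real_smul_left, re_inner_real_smul_left]

end OperatorConvexity

/-! ### The representation theorem -/

theorem theorem2 {H : Type u} [NormedAddCommGroup H] [InnerProductSpace ℂ H] [CompleteSpace H]
    (hdim : ¬ FiniteDimensional ℂ H)
    (F : (H →L[ℂ] H) → (H →L[ℂ] H) → (H →L[ℂ] H))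
    (hsa : ∀ A B : H →L[ℂ] H, 0 ≤ A → 0 ≤ B → IsSelfAdjoint (F A B))
    (hreg : IsRegularOperatorMap (psdPairs H) F)
    (hhom : ∀ (t : ℝ) (A B : H →L[ℂ] H), 0 < t → 0 ≤ A → 0 ≤ B →
      F (t • A) (t • B) = t • F A B)
    (hconv : ∀ A₁ A₂ B₁ B₂ : H →L[ℂ] H, 0 ≤ A₁ → 0 ≤ A₂ → 0 ≤ B₁ → 0 ≤ B₂ →
      F ((1 / 2 : ℝ) • (A₁ + A₂)) ((1 / 2 : ℝ) • (B₁ + B₂)) ≤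
        (1 / 2 : ℝ) • (F A₁ B₁ + F A₂ B₂))
    (hzero : F 0 0 = 0)
    (hcont : StronglyContinuousOnBounded (fun B => F 1 B) {B : H →L[ℂ] H | 0 ≤ B}) :
    ∃ f : ℝ → ℝ, OperatorConvexOn.{v} (Set.Ioi 0) f ∧
      (∀ t : ℝ, 0 < t → F 1 (t • 1) = f t • 1) ∧
      ∀ A B : H →L[ℂ] H, IsStrictlyPositive A → IsStrictlyPositive B →
        F A B = A ^ (1 / 2 : ℝ) *
          cfc f (A ^ (-(1 / 2) : ℝ) * B * A ^ (-(1 / 2) : ℝ)) * A ^ (1 / 2 : ℝ) := by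
  have hF := isRegularSublinear_of_regular hsa hreg hhom hconv hzero
  have : Nontrivial H := by
    by_contra h
    rw [not_nontrivial_iff_subsingleton] at h
    exact hdim inferInstance
  obtain ⟨f, hfc, hf⟩ := hF.exists_scalar_function hcont
  have hpersp : ∀ A B : H →L[ℂ] H, IsStrictlyPositive A → IsStrictlyPositive B →
      F A B = A ^ (1 / 2 : ℝ) *
        cfc f (A ^ (-(1 / 2) : ℝ) * B * A ^ (-(1 / 2) : ℝ)) * A ^ (1 / 2 : ℝ) := fun A B hA hB =>
    le_antisymm (hF.map_le_perspective hf hdim hfc hA hB) (hF.perspective_le hf hdim hfc hA hB)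
  have hone : ∀ B : H →L[ℂ] H, IsStrictlyPositive B → F 1 B = cfc f B := fun B hB => by
    have := hpersp 1 B isStrictlyPositive_one hB
    simpa using this
  refine ⟨f, operatorConvexOn_of_midpoint hdim hfc fun X Y hX hY => ?_,
    fun t ht => hf t ht.le, hpersp⟩
  have hXY : IsStrictlyPositive ((1 / 2 : ℝ) • (X + Y)) := by
    obtain ⟨a, -, ha0, -, -, haX, -, -⟩ := hX.exists_smul_one_le
    have := smul_le_smul_of_nonneg_left (add_le_add haX hY.nonneg)
      (show (0 : ℝ) ≤ 1 / 2 by norm_num)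
    rw [add_zero, smul_smul] at this
    exact isStrictlyPositive_of_smul_one_le (by positivity) this
  rw [← hone _ hXY, ← hone _ hX, ← hone _ hY]
  have := hconv 1 1 X Y zero_le_one zero_le_one hX.nonneg hY.nonneg
  have e : (1 / 2 : ℝ) • ((1 : H →L[ℂ] H) + 1) = 1 := by
    rw [← two_smul ℝ (1 : H →L[ℂ] H), smul_smul]
    norm_num
  rwa [e] at this
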